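/- **Setting.** Let $\mathcal X$ be a finite set of arms, $\phi:\mathcal X\to\mathcal H$ a feature map into a real Hilbert space, $\mu:\mathcal X\to\mathbb R$ with $|\mu_x|\le B$, and let $\theta_*\in\mathcal H$, $h\ge 0$ satisfy $|\mu_x-\langle\theta_*,\phi(x)\rangle|\le h$ for all $x$. Playing $x_t$ at time $t$ yields $y_t=\mu_{x_t}+\xi_t$, where $\xi_t$ is independent of $x_1,\dots,x_t,\xi_1,\dots,\xi_{t-1}$, $\mathbb E\xi_t=0$ and $\mathbb E\xi_t^2\le\sigma^2$. The regret is $R_T=\max_{x\in\mathcal X}\sum_{t=1}^T(\mu_x-\mu_{x_t})$. For $\gamma>0$, $\emptyset\ne\mathcal V\subset\mathcal X$ and $\lambda$ in the simplex $\triangle_{\mathcal V}$ put $A^{(\gamma)}(\lambda)=\sum_x\lambda_x\phi(x)\phi(x)^\top+\gamma I$, $\|v\|_{A^{-1}}=\sqrt{\langle v,A^{-1}v\rangle}$, and $$f(\lambda;\mathcal V,\gamma)=\max_{y\in\mathcal V}\|\phi(y)\|^2_{A^{(\gamma)}(\lambda)^{-1}},\qquad f(\mathcal V,\gamma)=\inf_{\lambda\in\triangle_{\mathcal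 V}}f(\lambda;\mathcal V,\gamma),\qquad \bar f=\max_{\mathcal V\subset\mathcal X}f(\mathcal V,\gamma).$$ A $\delta'$-robust mean estimator with constants $c_0,c_1>0$ is a measurable $\widehat\mu$ such that, for $n\ge c_1\log(1/\delta')$ i.i.d. samples with mean $\bar x$ and variance $\nu^2<\infty$, $|\widehat\mu(X_1,\dots,X_n)-\bar x|\le c_0\sqrt{\nu^2\log(1/\delta')/n}$ with probability at least $1-\delta'$. **Algorithm.** Its inputs are $\mathcal X,\phi,\delta\in(0,1),\gamma>0,\sigma,B,c_0,c_1$; it knows neither $h$ nor $\theta_*$. Start with $\mathcal X_1=\mathcal X$. In phase $\ell=1,2,\dots$, while $|\mathcal X_\ell|>1$: let $\lambda_\ell$ minimize $f(\lambda;\mathcal X_\ell,\gamma)$ over $\triangle_{\mathcal X_\ell}$; put $\epsilon_\ell=2^{-\ell}$, $\delta_\ell=\delta/(4\ell^2|\mathcal X|)$, $$\tau_\ell=\Big\lceil\max\big\{c_1\log(1/\delta_\ell),\;4c_0^2(B^2+\sigma^2)\epsilon_\ell^{-2}f(\mathcal X_\ell,\gamma)\log(1/\delta_\ell)\big\}\Big\rceil;$$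 play $\tau_\ell$ arms $\tilde x_1,\dots,\tilde x_{\tau_\ell}$ drawn independently from $\lambda_\ell$, with rewards $\tilde y_i$; for $x\in\mathcal X_\ell$ let $W^{(x)}$ be a $\delta_\ell$-robust mean estimator (with the constants $c_0,c_1$) applied to the numbers $\phi(x)^\top A^{(\gamma)}(\lambda_\ell)^{-1}\phi(\tilde x_i)\,\tilde y_i$, $i\le\tau_\ell$; let $\widehat\theta_\ell$ minimize $\max_{x\in\mathcal X_\ell}|\langle\theta,\phi(x)\rangle-W^{(x)}|/\|\phi(x)\|_{A^{(\gamma)}(\lambda_\ell)^{-1}}$ over $\theta\in\mathcal H$; and set $$\mathcal X_{\ell+1}=\Big\{x\in\mathcal X_\ell:\max_{x'\in\mathcal X_\ell}\langle\phi(x')-\phi(x),\widehat\theta_\ell\rangle<4\epsilon_\ell\Big\}.$$ Once $|\mathcal X_\ell|=1$, play its element indefinitely. Any choice of minimizers is allowed, as long as the values $\langle\widehat\theta_\ell,\phi(x)\rangle$ depend measurably on $W$. Assume that the $\xi_t$ are identically distributed, or else that the guarantee of the robust estimators also holds for independent samples with common mean and variances at most $\nu^2$. **Theorem.** For every $K$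 there is a constant $C>0$, depending on $K$ only, such that the following holds for every instance with $\mu_x-\mu_{x'}\le K$ for all $x,x'\in\mathcal X$, $c_1\ge 1/K$ and $\bar f\ge 1/K$. With probability at least $1-\delta$, simultaneously for all $T\ge2$, $$R_T\;\le\;C\left(c_1\log\frac{|\mathcal X|}{\delta}+\sqrt{\bar f}\,\Big(T\big(h+\sqrt\gamma\,\|\theta_*\|\big)+\sqrt{c_0^2(\sigma^2+B^2)\,T\,\log\big(|\mathcal X|\log(T)/\delta\big)}\Big)\right).$$ -/

import Mathlib

open MeasureTheory ProbabilityTheory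
open scoped BigOperators RealInnerProductSpace

universe u v w

noncomputable section

/-! ### Robust mean estimation -/

/-- `est` (one function of the sample for every sample size) is a `δ`-robust mean estimator with
constants `c₀, c₁`: on `n ≥ c₁ log (1/δ)` i.i.d. square-integrable samples it is within
`c₀ √(variance * log (1/δ) / n)` of the mean with probability at least `1 - δ`. -/
def IsRobust (c₀ c₁ δ : ℝ) (est : (n : ℕ) → (Fin n → ℝ) → ℝ) : Prop :=
  ∀ (n : ℕ) (ν : Measure ℝ) [IsProbabilityMeasure ν],
    c₁ * Real.log (1 / δ) ≤ n → MemLp (fun s : ℝ => s) 2 ν →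
    1 - δ ≤ (Measure.pi (fun _ : Fin n => ν)).real
      {s | |est n s - ∫ r, r ∂ν| ≤
        c₀ * √(Var[fun r : ℝ => r; ν] * Real.log (1 / δ) / n)}

/-- The same guarantee for independent samples that need not be identically distributed but have a
common mean `m` and variances at most `s2`. -/
def IsRobustIndep (c₀ c₁ δ : ℝ) (est : (n : ℕ) → (Fin n → ℝ) → ℝ) : Prop :=
  ∀ (n : ℕ) (ν : Fin n → Measure ℝ) [∀ i, IsProbabilityMeasure (ν i)] (m s2 : ℝ),
    c₁ * Real.log (1 / δ) ≤ n → 0 ≤ s2 →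
    (∀ i, MemLp (fun s : ℝ => s) 2 (ν i)) → (∀ i, ∫ r, r ∂(ν i) = m) →
    (∀ i, Var[fun r : ℝ => r; ν i] ≤ s2) →
    1 - δ ≤ (Measure.pi ν).real
      {s | |est n s - m| ≤ c₀ * √(s2 * Real.log (1 / δ) / n)}

/-! ### Regularized G-optimal design -/

section Design

variable {α : Type u} [Fintype α]
  {H : Type v} [NormedAddCommGroup H] [InnerProductSpace ℝ H]

/-- Probability vectors on the arm set that are supported on `V`. -/
def simplexOn (V : Finset α) : Set (α → ℝ) :=
  {lam | (∀ a, 0 ≤ lam a) ∧ (∀ a, a ∉ V → lam a = 0) ∧ ∑ a, lam a = 1}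

/-- `A^(γ)(λ) = ∑ₐ λₐ φ(a) φ(a)ᵀ + γ I`. -/
def designOp (φ : α → H) (γ : ℝ) (lam : α → ℝ) : H →L[ℝ] H :=
  ∑ a, lam a • InnerProductSpace.rankOne ℝ (φ a) (φ a) + γ • ContinuousLinearMap.id ℝ H

/-- `⟨v, A^(γ)(λ)⁻¹ w⟩`; for `γ > 0` and `λ ≥ 0` the operator is invertible. -/
def invForm (φ : α → H) (γ : ℝ) (lam : α → ℝ) (v w : H) : ℝ :=
  ⟪v, (designOp φ γ lam).inverse w⟫

/-- `‖v‖_{A^(γ)(λ)⁻¹}`. -/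
def invNorm (φ : α → H) (γ : ℝ) (lam : α → ℝ) (v : H) : ℝ :=
  √(invForm φ γ lam v v)

/-- `f(λ; V, γ) = max_{y ∈ V} ‖φ(y)‖²_{A^(γ)(λ)⁻¹}`. -/
def designObj (φ : α → H) (γ : ℝ) (V : Finset α) (lam : α → ℝ) : ℝ :=
  ⨆ y : V, invNorm φ γ lam (φ y) ^ 2

/-- `f(V, γ) = inf_{λ ∈ △_V} f(λ; V, γ)`. -/
def designValue (φ : α → H) (γ : ℝ) (V : Finset α) : ℝ :=
  ⨅ lam : simplexOn V, designObj φ γ V lam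

/-- `max_{V ⊆ 𝒳} f(V, γ)`; the empty set contributes the value `0` and does not matter. -/
def maxDesignValue (φ : α → H) (γ : ℝ) : ℝ :=
  ⨆ V : Finset α, designValue φ γ V

end Design

/-! ### The algorithm -/

/-- The inputs of the phased elimination algorithm on the arm set `α`, and the choices that it
makes. In phase `ℓ` with active set `V`, `est ℓ` is the robust mean estimator,
`design ℓ V` the chosen optimal design, and `fit ℓ V W` the chosen parameter vector when the
robust means of the active arms are `W`. -/
structure RIPSAlg (α : Type u) (H : Type v) where
  /-- the feature map -/
  φ : α → H
  /-- regularization -/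
  γ : ℝ
  /-- confidence level -/
  δ : ℝ
  /-- noise level -/
  σ : ℝ
  /-- bound on the mean rewards -/
  B : ℝ
  /-- accuracy constant of the robust estimators -/
  c₀ : ℝ
  /-- sample size constant of the robust estimators -/
  c₁ : ℝ
  /-- robust mean estimators -/
  est : ℕ → (n : ℕ) → (Fin n → ℝ) → ℝ
  /-- sampling designs -/
  design : ℕ → Finset α → α → ℝ
  /-- parameter estimates -/
  fit : ℕ → Finset α → (α → ℝ) → H

namespace RIPSAlg

variable {α : Type u} [Fintype α]
  {H : Type v} [NormedAddCommGroup H] [InnerProductSpace ℝ H] (alg : RIPSAlg α H)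

/-- The objective `max_{x ∈ V} |⟨θ, φ(x)⟩ - W⁽ˣ⁾| / ‖φ(x)‖_{A^(γ)(λ_ℓ)⁻¹}` of the parameter fit. -/
def fitObj (l : ℕ) (V : Finset α) (W : α → ℝ) (θ : H) : ℝ :=
  ⨆ x : V, |⟪θ, alg.φ x⟫ - W x| / invNorm alg.φ alg.γ (alg.design l V) (alg.φ x)

/-- Individual confidence of the robust means in phase `l`: `δ / (4 l² |𝒳|)`. -/
def phaseConf (l : ℕ) : ℝ := alg.δ / (4 * (l : ℝ) ^ 2 * Fintype.card α)

/-- The inputs are in their ranges and the choices are the prescribed ones: designs minimize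
`f(λ; V, γ)` over `△_V` and parameter estimates minimize `fitObj`. -/
structure Admissible : Prop where
  γ_pos : 0 < alg.γ
  δ_pos : 0 < alg.δ
  δ_lt_one : alg.δ < 1
  σ_nonneg : 0 ≤ alg.σ
  c₀_pos : 0 < alg.c₀
  c₁_pos : 0 < alg.c₁
  measurable_est : ∀ l n, Measurable (alg.est l n)
  design_mem : ∀ (l : ℕ) (V : Finset α), V.Nonempty → alg.design l V ∈ simplexOn V
  design_min : ∀ (l : ℕ) (V : Finset α), V.Nonempty → ∀ lam ∈ simplexOn V,
    designObj alg.φ alg.γ V (alg.design l V) ≤ designObj alg.φ alg.γ V lam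
  measurable_fit : ∀ (l : ℕ) (V : Finset α) (x : α),
    Measurable (fun W : α → ℝ => ⟪alg.fit l V W, alg.φ x⟫)
  fit_min : ∀ (l : ℕ) (V : Finset α), V.Nonempty → ∀ (W : α → ℝ) (θ : H),
    alg.fitObj l V W (alg.fit l V W) ≤ alg.fitObj l V W θ

/-- `ε_l = 2^{-l}`. -/
def eps (l : ℕ) : ℝ := ((2 : ℝ) ^ l)⁻¹

/-- `q⁽¹⁾_l = c₁ log (4 l² |𝒳| / δ)`. -/
def q1 (l : ℕ) : ℝ := alg.c₁ * Real.log (4 * (l : ℝ) ^ 2 * Fintype.card α / alg.δ)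

/-- `q⁽²⁾_l = 4 c₀² (B² + σ²) ε_l⁻² f(V, γ) log (4 l² |𝒳| / δ)`. -/
def q2 (l : ℕ) (V : Finset α) : ℝ :=
  4 * alg.c₀ ^ 2 * (alg.B ^ 2 + alg.σ ^ 2) * (eps l ^ 2)⁻¹ * designValue alg.φ alg.γ V *
    Real.log (4 * (l : ℝ) ^ 2 * Fintype.card α / alg.δ)

/-- Number of samples of phase `l` with active set `V`. -/
def tau (l : ℕ) (V : Finset α) : ℕ := ⌈max (alg.q1 l) (alg.q2 l V)⌉₊

/-- The robust means `W⁽ˣ⁾` computed in phase `l` with active set `V` from the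
(arm, reward) pairs `z 0, z 1, …, z (τ_l - 1)` of that phase. -/
def robustMeans (l : ℕ) (V : Finset α) (z : ℕ → α × ℝ) (x : α) : ℝ :=
  alg.est l (alg.tau l V) fun i =>
    invForm alg.φ alg.γ (alg.design l V) (alg.φ x) (alg.φ (z i).1) * (z i).2

open Classical in
/-- The active set after phase `l`: the `x ∈ V` with
`max_{x' ∈ V} ⟨φ(x') - φ(x), θ̂_l⟩ < 4 ε_l`. -/
def update (l : ℕ) (V : Finset α) (z : ℕ → α × ℝ) : Finset α :=
  V.filter fun x => ∀ x' ∈ V,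
    ⟪alg.φ x' - alg.φ x, alg.fit l V (alg.robustMeans l V z)⟫ < 4 * eps l

/-- First time and active set of phase `k + 1`, along the trajectory `z` of
(arm, reward) pairs indexed by time `0, 1, 2, …`. Once a single arm is active it remains active and
is the only one that can be sampled, so that continuing the phases from there on is
the same as playing that arm indefinitely. -/
def phase (z : ℕ → α × ℝ) : ℕ → ℕ × Finset α
  | 0 => (0, Finset.univ)
  | k + 1 =>
    ((phase z k).1 + alg.tau (k + 1) (phase z k).2,
      alg.update (k + 1) (phase z k).2 fun i => z ((phase z k).1 + i))

/-- The `k` for which time `t` belongs to phase `k + 1`. -/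
def phaseAt (z : ℕ → α × ℝ) (t : ℕ) : ℕ :=
  Nat.findGreatest (fun k => (alg.phase z k).1 ≤ t) t

/-- The probability with which the algorithm samples arm `a` at time `t`; it depends on the
trajectory before time `t` only. -/
def playProb (z : ℕ → α × ℝ) (t : ℕ) (a : α) : ℝ :=
  alg.design (alg.phaseAt z t + 1) (alg.phase z (alg.phaseAt z t)).2 a

end RIPSAlg

/-! ### The interaction -/

section Interaction

variable {α : Type u} [MeasurableSpace α] {Ω : Type w} [MeasurableSpace Ω]

/-- The additive noise `ξ`: at every time it is independent of the arms chosen up to and including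
that time and of the earlier noise (in particular the `ξ t` are independent), has mean zero
and second moment at most `σ²`. -/
structure IsNoise (P : Measure Ω) (σ : ℝ) (x : ℕ → Ω → α) (ξ : ℕ → Ω → ℝ) : Prop where
  measurable : ∀ t, Measurable (ξ t)
  indep : ∀ t, IndepFun (ξ t)
    (fun ω => ((fun i : Fin (t + 1) => x i ω), (fun i : Fin t => ξ i ω))) P
  memLp : ∀ t, MemLp (ξ t) 2 P
  mean_zero : ∀ t, ∫ ω, ξ t ω ∂P = 0
  second_moment : ∀ t, ∫ ω, ξ t ω ^ 2 ∂P ≤ σ ^ 2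

/-- The trajectory of pairs (arm `x_t`, reward `y_t = μ(x_t) + ξ_t`). -/
def trajectory (μ : α → ℝ) (x : ℕ → Ω → α) (ξ : ℕ → Ω → ℝ) (ω : Ω) (t : ℕ) : α × ℝ :=
  (x t ω, μ (x t ω) + ξ t ω)

/-- The arms are chosen by the algorithm: conditionally on the arms and rewards before
time `t`, the arm at time `t` is drawn from the distribution prescribed by the algorithm. -/
structure IsPlayedBy [Fintype α] {H : Type v} [NormedAddCommGroup H] [InnerProductSpace ℝ H]
    (alg : RIPSAlg α H) (P : Measure Ω) (μ : α → ℝ)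
    (x : ℕ → Ω → α) (ξ : ℕ → Ω → ℝ) : Prop where
  measurable : ∀ t, Measurable (x t)
  law : ∀ (t : ℕ) (a : α),
    P[Set.indicator {ω | x t ω = a} (fun _ => (1 : ℝ)) |
        MeasurableSpace.comap (fun ω => fun i : Fin t => trajectory μ x ξ ω i) inferInstance]
      =ᵐ[P] fun ω => alg.playProb (trajectory μ x ξ ω) t a

/-- The cumulative regret `max_a ∑_{t < T} (μ(a) - μ(x_t))`. -/
def regret (μ : α → ℝ) (x : ℕ → Ω → α) (T : ℕ) (ω : Ω) : ℝ :=
  ⨆ a, ∑ t ∈ Finset.range T, (μ a - μ (x t ω))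

end Interaction

end

/-! Fix a phase with design λ. The number φ(x)ᵀA⁻¹φ(x̃)ỹ has mean Σ_a λ_a⟨φ(x),A⁻¹φ(a)⟩μ_a and
variance at most (B²+σ²)‖φ(x)‖²_{A⁻¹}. The identity ‖v‖²_{A⁻¹} = Σ_a λ_a⟨v,A⁻¹φ(a)⟩² + γ‖A⁻¹v‖²
(`invForm_self`) shows that misspecification and regularization move this mean away from ⟨θ,φ(x)⟩ by
at most ‖φ(x)‖_{A⁻¹}(h+√γ‖θ‖). Both errors scale with the norm by which the minimax fit divides, so
comparing the fit with θ puts the fitted rewards within ε_l + 2√f(h+√γ‖θ‖) + h of μ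
(`MeansAccurate.abs_fit_sub_le`).

Let G bound the part that does not decay with l. As long as G < ε_l the best arm survives, and
active arms have gaps O(ε_l+G). At the first level with ε_l ≤ G the gaps are O(G), and they remain
so because active sets only shrink, even if the best arm is lost later (`gap_le_of_fit_accurate`).
This is why h need not be known. The regret is thus of order Σ_t ε_{l(t)} + TG. With Q the square
root term of the bound, phases with 2^l above about T/Q cost at most about Q in total, and over the
earlier ones τ_l ε_l sums geometrically (`sum_eps_phaseAt_le`).

For the probability, start times and active sets are random. The event that a phase starts at time s
with active set V belongs to the history at s, and on it the weighted rewards of the phase are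
independent with known laws (`measure_inter_weighted_rewards_mem`). For one phase these events are
disjoint, so a union bound is paid only over arms and phases (`one_sub_le_measure_accurate`). -/

noncomputable section

/-! ### The regularized design operator and the bias of inverse propensity scoring. -/

section DesignOperator

variable {α : Type u} [Fintype α]
  {H : Type v} [NormedAddCommGroup H] [InnerProductSpace ℝ H]

lemma inner_designOp (φ : α → H) (γ : ℝ) (lam : α → ℝ) (v w : H) :
    ⟪v, designOp φ γ lam w⟫ = ∑ a, lam a * (⟪v, φ a⟫ * ⟪φ a, w⟫) + γ * ⟪v, w⟫ := by
  simp [designOp, inner_add_right, inner_sum, inner_smul_right,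
    InnerProductSpace.rankOne_apply, mul_comm]

lemma inner_designOp_symm (φ : α → H) (γ : ℝ) (lam : α → ℝ) (v w : H) :
    ⟪designOp φ γ lam v, w⟫ = ⟪v, designOp φ γ lam w⟫ := by
  rw [real_inner_comm, inner_designOp, inner_designOp, real_inner_comm v w]
  congr 1
  refine Finset.sum_congr rfl fun a _ => ?_
  rw [real_inner_comm w, real_inner_comm v]
  ring

lemma sum_mul_abs_le_sqrt {lam c : α → ℝ} (h0 : ∀ a, 0 ≤ lam a) (h1 : ∑ a, lam a = 1) :
    ∑ a, lam a * |c a| ≤ √(∑ a, lam a * c a ^ 2) := by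
  apply Real.le_sqrt_of_sq_le
  have := Finset.sum_sq_le_sum_mul_sum_of_sq_le_mul Finset.univ (r := fun a => lam a * |c a|)
    (f := lam) (g := fun a => lam a * c a ^ 2) (fun a _ => h0 a)
    (fun a _ => mul_nonneg (h0 a) (sq_nonneg _))
    (fun a _ => by rw [mul_pow, sq_abs]; exact le_of_eq (by ring))
  simpa [h1] using this

lemma invNorm_nonneg (φ : α → H) (γ : ℝ) (lam : α → ℝ) (v : H) : 0 ≤ invNorm φ γ lam v :=
  Real.sqrt_nonneg _

lemma invNorm_sq_le_designObj (φ : α → H) (γ : ℝ) {V : Finset α} (lam : α → ℝ) {y : α}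
    (hy : y ∈ V) : invNorm φ γ lam (φ y) ^ 2 ≤ designObj φ γ V lam :=
  le_ciSup (f := fun y : V => invNorm φ γ lam (φ y) ^ 2) (Set.finite_range _).bddAbove ⟨y, hy⟩

lemma designObj_nonneg (φ : α → H) (γ : ℝ) (V : Finset α) (lam : α → ℝ) :
    0 ≤ designObj φ γ V lam :=
  Real.iSup_nonneg fun _ => sq_nonneg _

lemma designValue_nonneg (φ : α → H) (γ : ℝ) (V : Finset α) : 0 ≤ designValue φ γ V :=
  Real.iInf_nonneg fun _ => designObj_nonneg _ _ _ _

lemma designValue_le_max (φ : α → H) (γ : ℝ) (V : Finset α) :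
    designValue φ γ V ≤ maxDesignValue φ γ :=
  le_ciSup (f := fun V => designValue φ γ V) (Set.finite_range _).bddAbove V

lemma designObj_le_designValue (φ : α → H) (γ : ℝ) (V : Finset α) {lam : α → ℝ}
    (hmem : lam ∈ simplexOn V)
    (hmin : ∀ lam' ∈ simplexOn V, designObj φ γ V lam ≤ designObj φ γ V lam') :
    designObj φ γ V lam ≤ designValue φ γ V :=
  have : Nonempty (simplexOn V) := ⟨⟨lam, hmem⟩⟩
  le_ciInf fun l => hmin l l.2

variable [CompleteSpace H]

/-- Lax–Milgram: the rank-one terms are nonnegative, so the quadratic form is at least γ‖u‖². This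
is what makes `inverse` a genuine inverse rather than its default value. -/
lemma designOp_isInvertible (φ : α → H) {γ : ℝ} (hγ : 0 < γ) {lam : α → ℝ}
    (h0 : ∀ a, 0 ≤ lam a) : (designOp φ γ lam).IsInvertible := by
  have hB : IsCoercive ((innerSL ℝ).comp (designOp φ γ lam) : H →L[ℝ] H →L[ℝ] ℝ) := by
    refine ⟨γ, hγ, fun u => ?_⟩
    have : (0 : ℝ) ≤ ∑ a, lam a * (⟪u, φ a⟫ * ⟪φ a, u⟫) :=
      Finset.sum_nonneg fun a _ => mul_nonneg (h0 a) (by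
        rw [real_inner_comm]; exact mul_self_nonneg _)
    have h2 : ((innerSL ℝ).comp (designOp φ γ lam) : H →L[ℝ] H →L[ℝ] ℝ) u u
        = ⟪designOp φ γ lam u, u⟫ := rfl
    rw [h2, inner_designOp_symm, inner_designOp, real_inner_self_eq_norm_sq]
    nlinarith
  refine ⟨hB.continuousLinearEquivOfBilin, ?_⟩
  ext u
  refine ext_inner_right ℝ fun w => ?_
  exact hB.continuousLinearEquivOfBilin_apply u w

lemma designOp_inverse_apply (φ : α → H) {γ : ℝ} (hγ : 0 < γ) {lam : α → ℝ}
    (h0 : ∀ a, 0 ≤ lam a) (v : H) :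
    designOp φ γ lam ((designOp φ γ lam).inverse v) = v :=
  (designOp_isInvertible φ hγ h0).self_apply_inverse v

lemma invForm_comm (φ : α → H) {γ : ℝ} (hγ : 0 < γ) {lam : α → ℝ}
    (h0 : ∀ a, 0 ≤ lam a) (v w : H) : invForm φ γ lam v w = invForm φ γ lam w v := by
  unfold invForm
  nth_rw 1 [← designOp_inverse_apply φ hγ h0 v]
  rw [inner_designOp_symm, designOp_inverse_apply φ hγ h0, real_inner_comm]

/-- Expand ⟨R, A R⟩ at R = A⁻¹v. The first summand controls variance and misspecification, the
second the bias due to γ. -/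
lemma invForm_self (φ : α → H) {γ : ℝ} (hγ : 0 < γ) {lam : α → ℝ}
    (h0 : ∀ a, 0 ≤ lam a) (v : H) :
    invForm φ γ lam v v = ∑ a, lam a * invForm φ γ lam v (φ a) ^ 2
      + γ * ‖(designOp φ γ lam).inverse v‖ ^ 2 := by
  have h1 : invForm φ γ lam v v =
      ⟪(designOp φ γ lam).inverse v, designOp φ γ lam ((designOp φ γ lam).inverse v)⟫ := by
    rw [designOp_inverse_apply φ hγ h0, real_inner_comm]; rfl
  rw [h1, inner_designOp, real_inner_self_eq_norm_sq]
  congr 1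
  refine Finset.sum_congr rfl fun a _ => ?_
  rw [invForm_comm φ hγ h0, invForm, real_inner_comm]
  ring

lemma invForm_self_nonneg (φ : α → H) {γ : ℝ} (hγ : 0 < γ) {lam : α → ℝ}
    (h0 : ∀ a, 0 ≤ lam a) (v : H) : 0 ≤ invForm φ γ lam v v := by
  rw [invForm_self φ hγ h0]
  exact add_nonneg (Finset.sum_nonneg fun a _ => mul_nonneg (h0 a) (sq_nonneg _)) (by positivity)

lemma sq_invNorm (φ : α → H) {γ : ℝ} (hγ : 0 < γ) {lam : α → ℝ}
    (h0 : ∀ a, 0 ≤ lam a) (v : H) : invNorm φ γ lam v ^ 2 = invForm φ γ lam v v :=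
  Real.sq_sqrt (invForm_self_nonneg φ hγ h0 v)

lemma sum_mul_sq_invForm_le (φ : α → H) {γ : ℝ} (hγ : 0 < γ) {lam : α → ℝ}
    (h0 : ∀ a, 0 ≤ lam a) (v : H) :
    ∑ a, lam a * invForm φ γ lam v (φ a) ^ 2 ≤ invNorm φ γ lam v ^ 2 := by
  rw [sq_invNorm φ hγ h0, invForm_self φ hγ h0]
  have : 0 ≤ γ * ‖(designOp φ γ lam).inverse v‖ ^ 2 := by positivity
  linarith

lemma sqrt_mul_norm_inverse_le (φ : α → H) {γ : ℝ} (hγ : 0 < γ) {lam : α → ℝ}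
    (h0 : ∀ a, 0 ≤ lam a) (v : H) :
    √γ * ‖(designOp φ γ lam).inverse v‖ ≤ invNorm φ γ lam v := by
  apply Real.le_sqrt_of_sq_le
  rw [mul_pow, Real.sq_sqrt hγ.le, invForm_self φ hγ h0]
  have : 0 ≤ ∑ a, lam a * invForm φ γ lam v (φ a) ^ 2 :=
    Finset.sum_nonneg fun a _ => mul_nonneg (h0 a) (sq_nonneg _)
  linarith

lemma eq_zero_of_invNorm_eq_zero (φ : α → H) {γ : ℝ} (hγ : 0 < γ) {lam : α → ℝ}
    (h0 : ∀ a, 0 ≤ lam a) {v : H} (hv : invNorm φ γ lam v = 0) : v = 0 := by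
  have h1 := sqrt_mul_norm_inverse_le φ hγ h0 v
  rw [hv] at h1
  have h2 : 0 < √γ := Real.sqrt_pos.2 hγ
  have h3 : (designOp φ γ lam).inverse v = 0 := by
    rw [← norm_le_zero_iff]
    by_contra h
    push Not at h
    nlinarith [mul_pos h2 h]
  rw [← designOp_inverse_apply φ hγ h0 v, h3, map_zero]

/-- The bias of the regularized, misspecified inverse propensity estimate. -/
lemma abs_sum_invForm_sub_inner_le (φ : α → H) {γ : ℝ} (hγ : 0 < γ) {lam : α → ℝ}
    (h0 : ∀ a, 0 ≤ lam a) (h1 : ∑ a, lam a = 1) {μ : α → ℝ} {θ : H} {h : ℝ}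
    (hμ : ∀ a, |μ a - ⟪θ, φ a⟫| ≤ h) (hh : 0 ≤ h) (v : H) :
    |∑ a, lam a * (invForm φ γ lam v (φ a) * μ a) - ⟪θ, v⟫|
      ≤ invNorm φ γ lam v * (h + √γ * ‖θ‖) := by
  set R := (designOp φ γ lam).inverse v with hR
  -- Writing v = A A⁻¹v expresses ⟨θ,v⟩ as the estimate's mean under exactly linear rewards plus a
  -- term in γ; only the deviations from linearity then remain.
  have e1 : ⟪θ, v⟫ = ∑ a, lam a * (⟪θ, φ a⟫ * invForm φ γ lam v (φ a)) + γ * ⟪θ, R⟫ := by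
    nth_rw 1 [← designOp_inverse_apply φ hγ h0 v]
    rw [inner_designOp]
    congr 1
    refine Finset.sum_congr rfl fun a _ => ?_
    rw [invForm_comm φ hγ h0]; rfl
  have e2 : ∑ a, lam a * (invForm φ γ lam v (φ a) * μ a) - ⟪θ, v⟫ =
      ∑ a, lam a * (invForm φ γ lam v (φ a) * (μ a - ⟪θ, φ a⟫)) - γ * ⟪θ, R⟫ := by
    rw [e1, ← sub_sub, ← Finset.sum_sub_distrib]
    congr 1
    exact Finset.sum_congr rfl fun a _ => by ring
  rw [e2]
  have b1 : |∑ a, lam a * (invForm φ γ lam v (φ a) * (μ a - ⟪θ, φ a⟫))|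
      ≤ invNorm φ γ lam v * h := by
    calc _ ≤ ∑ a, |lam a * (invForm φ γ lam v (φ a) * (μ a - ⟪θ, φ a⟫))| :=
          Finset.abs_sum_le_sum_abs _ _
      _ ≤ ∑ a, (lam a * |invForm φ γ lam v (φ a)|) * h := by
          refine Finset.sum_le_sum fun a _ => ?_
          rw [abs_mul, abs_mul, abs_of_nonneg (h0 a), ← mul_assoc]
          exact mul_le_mul_of_nonneg_left (hμ a) (mul_nonneg (h0 a) (abs_nonneg _))
      _ = (∑ a, lam a * |invForm φ γ lam v (φ a)|) * h := by rw [Finset.sum_mul]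
      _ ≤ invNorm φ γ lam v * h := by
          refine mul_le_mul_of_nonneg_right ((sum_mul_abs_le_sqrt h0 h1).trans ?_) hh
          exact Real.sqrt_le_iff.2 ⟨invNorm_nonneg _ _ _ _, sum_mul_sq_invForm_le φ hγ h0 v⟩
  have b2 : |γ * ⟪θ, R⟫| ≤ invNorm φ γ lam v * (√γ * ‖θ‖) := by
    rw [abs_mul, abs_of_pos hγ]
    have h2 := abs_real_inner_le_norm θ R
    have h3 := sqrt_mul_norm_inverse_le φ hγ h0 v
    have h4 := Real.mul_self_sqrt hγ.le
    calc γ * |⟪θ, R⟫| ≤ γ * (‖θ‖ * ‖R‖) := mul_le_mul_of_nonneg_left h2 hγ.le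
      _ = (√γ * ‖R‖) * (√γ * ‖θ‖) := by rw [← h4]; simp only [Real.sqrt_mul_self (Real.sqrt_nonneg γ)]; ring
      _ ≤ _ := mul_le_mul_of_nonneg_right h3 (by positivity)
  rw [mul_add]
  exact (abs_sub _ _).trans (add_le_add b1 b2)

end DesignOperator

/-! ### Accuracy of the fit in a single phase. -/

namespace RIPSAlg

lemma eps_pos (l : ℕ) : 0 < eps l := by unfold eps; positivity

lemma eps_succ (l : ℕ) : eps l = 2 * eps (l + 1) := by
  unfold eps; rw [pow_succ]; field_simp

lemma inv_phaseConf {α : Type u} [Fintype α] {H : Type v} {alg : RIPSAlg α H} (l : ℕ) :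
    1 / alg.phaseConf l = 4 * (l : ℝ) ^ 2 * Fintype.card α / alg.δ := by
  unfold phaseConf; rw [one_div_div]

section Deterministic

variable {α : Type u} [Fintype α]
  {H : Type v} [NormedAddCommGroup H] [InnerProductSpace ℝ H] {alg : RIPSAlg α H}

/-- The accuracy guaranteed for the robust means of phase `l` with active set `V`. -/
def MeansAccurate (alg : RIPSAlg α H) (μ : α → ℝ) (l : ℕ) (V : Finset α) (z : ℕ → α × ℝ) : Prop :=
  ∀ x ∈ V, |alg.robustMeans l V z x -
      ∑ a, alg.design l V a * (invForm alg.φ alg.γ (alg.design l V) (alg.φ x) (alg.φ a) * μ a)| ≤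
    alg.c₀ * √((alg.B ^ 2 + alg.σ ^ 2) *
      invNorm alg.φ alg.γ (alg.design l V) (alg.φ x) ^ 2 *
        Real.log (1 / alg.phaseConf l) / alg.tau l V)

lemma one_lt_inv_phaseConf [Nonempty α] (hA : alg.Admissible) {l : ℕ} (hl : 1 ≤ l) :
    1 < 4 * (l : ℝ) ^ 2 * Fintype.card α / alg.δ := by
  rw [one_lt_div hA.δ_pos]
  have h1 : (1 : ℝ) ≤ l := by exact_mod_cast hl
  have h2 : (1 : ℝ) ≤ Fintype.card α := by exact_mod_cast Fintype.card_pos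
  have h3 := hA.δ_lt_one
  nlinarith [mul_le_mul (one_le_pow₀ (n := 2) h1) h2 zero_le_one (by positivity)]

lemma log_inv_phaseConf_pos [Nonempty α] (hA : alg.Admissible) {l : ℕ} (hl : 1 ≤ l) :
    0 < Real.log (4 * (l : ℝ) ^ 2 * Fintype.card α / alg.δ) :=
  Real.log_pos (one_lt_inv_phaseConf hA hl)

lemma q1_pos [Nonempty α] (hA : alg.Admissible) {l : ℕ} (hl : 1 ≤ l) : 0 < alg.q1 l :=
  mul_pos hA.c₁_pos (log_inv_phaseConf_pos hA hl)

lemma tau_pos [Nonempty α] (hA : alg.Admissible) {l : ℕ} (hl : 1 ≤ l) (V : Finset α) :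
    0 < alg.tau l V :=
  Nat.ceil_pos.2 (lt_max_of_lt_left (q1_pos hA hl))

lemma q1_le_tau (l : ℕ) (V : Finset α) : alg.q1 l ≤ alg.tau l V :=
  (le_max_left _ _).trans (Nat.le_ceil _)

lemma q2_le_tau (l : ℕ) (V : Finset α) : alg.q2 l V ≤ alg.tau l V :=
  (le_max_right _ _).trans (Nat.le_ceil _)

lemma q2_nonneg [Nonempty α] (hA : alg.Admissible) {l : ℕ} (hl : 1 ≤ l) (V : Finset α) :
    0 ≤ alg.q2 l V := by
  have h1 := (log_inv_phaseConf_pos hA hl).le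
  have h2 := designValue_nonneg alg.φ alg.γ V
  unfold q2
  positivity

lemma tau_le [Nonempty α] (hA : alg.Admissible) {l : ℕ} (hl : 1 ≤ l) (V : Finset α) :
    (alg.tau l V : ℝ) ≤ alg.q1 l + alg.q2 l V + 1 := by
  have h1 := (q1_pos hA hl).le
  have h2 := q2_nonneg hA hl V
  have h3 : max (alg.q1 l) (alg.q2 l V) ≤ alg.q1 l + alg.q2 l V :=
    max_le (by linarith) (by linarith)
  have h4 := Nat.ceil_lt_add_one (h1.trans (le_max_left _ (alg.q2 l V)))
  unfold tau
  linarith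

/-- The statistical error of a phase is at most half its target accuracy. -/
lemma sqrt_designValue_mul_le [Nonempty α] (hA : alg.Admissible) {l : ℕ} (hl : 1 ≤ l)
    (V : Finset α) :
    √(designValue alg.φ alg.γ V) * (alg.c₀ * √((alg.B ^ 2 + alg.σ ^ 2) *
      Real.log (1 / alg.phaseConf l) / alg.tau l V)) ≤ eps l / 2 := by
  have hτ : (0 : ℝ) < alg.tau l V := by exact_mod_cast tau_pos hA hl V
  have hL := (log_inv_phaseConf_pos hA hl).le
  have h2 := designValue_nonneg alg.φ alg.γ V
  have he := eps_pos l
  have hc := hA.c₀_pos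
  rw [inv_phaseConf, mul_left_comm, ← Real.sqrt_mul h2]
  have : √(designValue alg.φ alg.γ V * ((alg.B ^ 2 + alg.σ ^ 2) *
      Real.log (4 * (l : ℝ) ^ 2 * Fintype.card α / alg.δ) / alg.tau l V)) ≤
      eps l / (2 * alg.c₀) := by
    rw [Real.sqrt_le_left (by positivity), ← mul_div_assoc, div_le_iff₀ hτ]
    have hq := q2_le_tau (alg := alg) l V
    unfold q2 at hq
    calc _ = (eps l / (2 * alg.c₀)) ^ 2 * (4 * alg.c₀ ^ 2 * (alg.B ^ 2 + alg.σ ^ 2) *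
          (eps l ^ 2)⁻¹ * designValue alg.φ alg.γ V *
          Real.log (4 * (l : ℝ) ^ 2 * Fintype.card α / alg.δ)) := by
          field_simp
          ring
      _ ≤ _ := mul_le_mul_of_nonneg_left hq (by positivity)
  calc _ ≤ alg.c₀ * (eps l / (2 * alg.c₀)) := mul_le_mul_of_nonneg_left this hc.le
    _ = _ := by field_simp

variable [CompleteSpace H]

/-- Accurate robust means make the fitted rewards accurate. -/
lemma MeansAccurate.abs_fit_sub_le (hA : alg.Admissible) {μ : α → ℝ} {θ : H} {h : ℝ}
    (hμ : ∀ a, |μ a - ⟪θ, alg.φ a⟫| ≤ h) {l : ℕ} (hl : 1 ≤ l) {V : Finset α}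
    {z : ℕ → α × ℝ} (hz : alg.MeansAccurate μ l V z) {x : α} (hx : x ∈ V) :
    |⟪alg.fit l V (alg.robustMeans l V z), alg.φ x⟫ - μ x| ≤
      eps l + 2 * √(designValue alg.φ alg.γ V) * (h + √alg.γ * ‖θ‖) + h := by
  have : Nonempty α := ⟨x⟩
  have hV : V.Nonempty := ⟨x, hx⟩
  have hh : 0 ≤ h := (abs_nonneg _).trans (hμ x)
  obtain ⟨h0, -, h1⟩ := hA.design_mem l V hV
  have hγ := hA.γ_pos
  set W := alg.robustMeans l V z with hW
  set N : α → ℝ := fun x => invNorm alg.φ alg.γ (alg.design l V) (alg.φ x) with hN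
  set r := alg.c₀ * √((alg.B ^ 2 + alg.σ ^ 2) *
      Real.log (1 / alg.phaseConf l) / alg.tau l V) with hr
  set b := h + √alg.γ * ‖θ‖ with hb
  have hN0 : ∀ x, 0 ≤ N x := fun x => invNorm_nonneg _ _ _ _
  have hr0 : 0 ≤ r := mul_nonneg hA.c₀_pos.le (Real.sqrt_nonneg _)
  have hb0 : 0 ≤ b := by positivity
  -- Statistical error and bias are both proportional to `N y`, so θ has fit objective at most `r +
  -- b` whatever the arm.
  have key : ∀ y ∈ V, |⟪θ, alg.φ y⟫ - W y| ≤ N y * (r + b) := by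
    intro y hy
    have e1 := hz y hy
    have e2 := abs_sum_invForm_sub_inner_le alg.φ hγ h0 h1 hμ hh (alg.φ y)
    have e3 : alg.c₀ * √((alg.B ^ 2 + alg.σ ^ 2) *
      invNorm alg.φ alg.γ (alg.design l V) (alg.φ y) ^ 2 *
        Real.log (1 / alg.phaseConf l) / alg.tau l V) = N y * r := by
      have : (alg.B ^ 2 + alg.σ ^ 2) *
        invNorm alg.φ alg.γ (alg.design l V) (alg.φ y) ^ 2 *
        Real.log (1 / alg.phaseConf l) / alg.tau l V = N y ^ 2 * ((alg.B ^ 2 + alg.σ ^ 2) *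
          Real.log (1 / alg.phaseConf l) / alg.tau l V) := by rw [hN]; ring
      rw [this, Real.sqrt_mul (sq_nonneg _), Real.sqrt_sq (hN0 y), hr]
      ring
    rw [e3] at e1
    rw [abs_sub_comm] at e2
    have := abs_sub_le ⟪θ, alg.φ y⟫ (∑ a, alg.design l V a *
      (invForm alg.φ alg.γ (alg.design l V) (alg.φ y) (alg.φ a) * μ a)) (W y)
    rw [abs_sub_comm (∑ a, _) (W y)] at this
    rw [mul_add]
    linarith
  have hobj : alg.fitObj l V W θ ≤ r + b := by
    have : Nonempty V := ⟨⟨x, hx⟩⟩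
    refine ciSup_le fun y => ?_
    exact div_le_of_le_mul₀ (hN0 y) (by positivity) (by rw [mul_comm]; exact key y y.2)
  have hobj' : ∀ y ∈ V, |⟪alg.fit l V W, alg.φ y⟫ - W y| / N y ≤ r + b := fun y hy =>
    (le_ciSup (f := fun y : V => |⟪alg.fit l V W, alg.φ y⟫ - W y| / N y)
      (Set.finite_range _).bddAbove ⟨y, hy⟩).trans ((hA.fit_min l V hV W θ).trans hobj)
  have hdiff : |⟪alg.fit l V W, alg.φ x⟫ - ⟪θ, alg.φ x⟫| ≤ 2 * N x * (r + b) := by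
    -- When `N x = 0` the quotient in `fitObj` is 0 by convention and carries no information, but
    -- then φ(x) = 0 and both predictions vanish.
    rcases (hN0 x).eq_or_lt with hz0 | hpos
    · have : alg.φ x = 0 := eq_zero_of_invNorm_eq_zero alg.φ hγ h0 hz0.symm
      simp [this, ← hz0]
    · have e1 := hobj' x hx
      rw [div_le_iff₀ hpos] at e1
      have e2 := key x hx
      have := abs_sub_le ⟪alg.fit l V W, alg.φ x⟫ (W x) ⟪θ, alg.φ x⟫
      rw [abs_sub_comm (W x)] at this
      linarith
  have hNf : N x ≤ √(designValue alg.φ alg.γ V) :=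
    Real.le_sqrt_of_sq_le ((invNorm_sq_le_designObj _ _ _ hx).trans
      (designObj_le_designValue _ _ _ (hA.design_mem l V hV) (hA.design_min l V hV)))
  have hstat := sqrt_designValue_mul_le hA hl V
  have h5 : N x * (r + b) ≤ √(designValue alg.φ alg.γ V) * (r + b) :=
    mul_le_mul_of_nonneg_right hNf (by positivity)
  have h6 := hμ x
  rw [abs_sub_comm] at h6
  have := abs_sub_le ⟪alg.fit l V W, alg.φ x⟫ ⟪θ, alg.φ x⟫ (μ x)
  linarith [mul_add √(designValue alg.φ alg.γ V) r b]

end Deterministic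

/-! ### Phase boundaries and active sets along a trajectory. -/

section Phases

variable {α : Type u} [Fintype α]
  {H : Type v} [NormedAddCommGroup H] [InnerProductSpace ℝ H] {alg : RIPSAlg α H}

lemma mem_update {l : ℕ} {V : Finset α} {z : ℕ → α × ℝ} {x : α} :
    x ∈ alg.update l V z ↔ x ∈ V ∧ ∀ x' ∈ V,
      ⟪alg.fit l V (alg.robustMeans l V z), alg.φ x'⟫
        - ⟪alg.fit l V (alg.robustMeans l V z), alg.φ x⟫ < 4 * eps l := by
  simp only [update, Finset.mem_filter, inner_sub_left, real_inner_comm]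

lemma update_subset (l : ℕ) (V : Finset α) (z : ℕ → α × ℝ) : alg.update l V z ⊆ V :=
  fun _ hx => (mem_update.1 hx).1

/-- The maximizer of the fitted reward always passes the test. -/
lemma update_nonempty {l : ℕ} {V : Finset α} (hV : V.Nonempty) (z : ℕ → α × ℝ) :
    (alg.update l V z).Nonempty := by
  obtain ⟨x, hx, hmax⟩ := V.exists_max_image
    (fun x => ⟪alg.fit l V (alg.robustMeans l V z), alg.φ x⟫) hV
  exact ⟨x, mem_update.2 ⟨hx, fun x' hx' => by linarith [hmax x' hx', eps_pos l]⟩⟩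

lemma phase_snd_nonempty [Nonempty α] (z : ℕ → α × ℝ) (k : ℕ) : (alg.phase z k).2.Nonempty := by
  induction k with
  | zero => exact Finset.univ_nonempty
  | succ k ih => exact update_nonempty ih _

lemma phase_snd_antitone (z : ℕ → α × ℝ) : Antitone fun k => (alg.phase z k).2 :=
  antitone_nat_of_succ_le fun _ => update_subset _ _ _

lemma phase_fst_strictMono [Nonempty α] (hA : alg.Admissible) (z : ℕ → α × ℝ) :
    StrictMono fun k => (alg.phase z k).1 :=
  strictMono_nat_of_lt_succ fun k =>
    Nat.lt_add_of_pos_right (tau_pos hA (Nat.le_add_left 1 k) (alg.phase z k).2)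

lemma phaseAt_le (z : ℕ → α × ℝ) (t : ℕ) : alg.phaseAt z t ≤ t := Nat.findGreatest_le t

lemma phase_phaseAt_le (z : ℕ → α × ℝ) (t : ℕ) : (alg.phase z (alg.phaseAt z t)).1 ≤ t :=
  Nat.findGreatest_spec (P := fun k => (alg.phase z k).1 ≤ t) (Nat.zero_le t) (Nat.zero_le t)

/-- Start times are strictly increasing naturals, so the start of index k is at least k, and the
search bound `t` in `phaseAt` excludes nothing. -/
lemma lt_phase_phaseAt_succ [Nonempty α] (hA : alg.Admissible) (z : ℕ → α × ℝ) (t : ℕ) :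
    t < (alg.phase z (alg.phaseAt z t + 1)).1 := by
  by_contra hcon
  push Not at hcon
  have h1 : alg.phaseAt z t + 1 ≤ t :=
    ((phase_fst_strictMono hA z).le_apply).trans hcon
  exact Nat.findGreatest_is_greatest (P := fun k => (alg.phase z k).1 ≤ t)
    (Nat.lt_succ_self (alg.phaseAt z t)) h1 hcon

lemma phaseAt_eq [Nonempty α] (hA : alg.Admissible) {z : ℕ → α × ℝ} {t k : ℕ}
    (h1 : (alg.phase z k).1 ≤ t) (h2 : t < (alg.phase z (k + 1)).1) : alg.phaseAt z t = k := by
  have m := phase_fst_strictMono hA z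
  have h3 := m.lt_iff_lt.1 (h1.trans_lt (lt_phase_phaseAt_succ hA z t))
  have h4 := m.lt_iff_lt.1 ((phase_phaseAt_le (alg := alg) z t).trans_lt h2)
  omega

lemma playProb_eq [Nonempty α] (hA : alg.Admissible) {z : ℕ → α × ℝ} {t k s : ℕ}
    {V : Finset α} (hk : alg.phase z k = (s, V)) (h1 : s ≤ t) (h2 : t < s + alg.tau (k + 1) V) :
    alg.playProb z t = alg.design (k + 1) V := by
  have h3 : (alg.phase z (k + 1)).1 = s + alg.tau (k + 1) V := by simp [phase, hk]
  have := phaseAt_eq hA (z := z) (t := t) (k := k) (by rw [hk]; exact h1) (by rw [h3]; exact h2)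
  funext a
  simp [playProb, this, hk]

lemma card_phaseAt_eq_le [Nonempty α] (hA : alg.Admissible) (z : ℕ → α × ℝ) (T k : ℕ) :
    ((Finset.range T).filter fun t => alg.phaseAt z t = k).card ≤
      alg.tau (k + 1) (alg.phase z k).2 := by
  calc _ ≤ (Finset.Ico (alg.phase z k).1 (alg.phase z (k + 1)).1).card := by
        refine Finset.card_le_card fun t ht => ?_
        obtain ⟨-, rfl⟩ := Finset.mem_filter.1 ht
        exact Finset.mem_Ico.2 ⟨phase_phaseAt_le z t, lt_phase_phaseAt_succ hA z t⟩
    _ = _ := by simp [phase]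

end Phases

/-! ### Gaps of the active arms. -/

section Gap

variable {α : Type u} [Fintype α]
  {H : Type v} [NormedAddCommGroup H] [InnerProductSpace ℝ H] {alg : RIPSAlg α H}

/-- If the fitted rewards of every phase are accurate up to `ε_l + G`, then the arms that are
active in a phase have gaps of order `ε_l + G`. -/
lemma gap_le_of_fit_accurate {μ : α → ℝ} {z : ℕ → α × ℝ} {G K : ℝ} (hG : 0 ≤ G) (hK : 0 ≤ K)
    (hμK : ∀ a b, μ a - μ b ≤ K)
    (hacc : ∀ k, ∀ x ∈ (alg.phase z k).2,
      |⟪alg.fit (k + 1) (alg.phase z k).2 (alg.robustMeans (k + 1) (alg.phase z k).2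
        fun i => z ((alg.phase z k).1 + i)), alg.φ x⟫ - μ x| ≤ eps (k + 1) + G)
    (k : ℕ) {x : α} (hx : x ∈ (alg.phase z k).2) (a : α) :
    μ a - μ x ≤ (24 + 4 * K) * (eps (k + 1) + G) := by
  have : Nonempty α := ⟨x⟩
  obtain ⟨best, hbest⟩ := Finite.exists_max μ
  -- With `G < eps` each fitted value is off by less than 2ε, so no arm can beat the best one by the
  -- elimination margin 4ε.
  have survive : ∀ k, (∀ j < k, G < eps (j + 1)) → best ∈ (alg.phase z k).2 := by
    intro k
    induction k with
    | zero => exact fun _ => Finset.mem_univ _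
    | succ k ih =>
      intro hj
      have hb := ih fun j hjk => hj j (hjk.trans (Nat.lt_succ_self k))
      refine mem_update.2 ⟨hb, fun x' hx' => ?_⟩
      have h1 := abs_le.1 (hacc k x' hx')
      have h2 := abs_le.1 (hacc k best hb)
      have h3 := hbest x'
      have h4 := hj k (Nat.lt_succ_self k)
      linarith
  -- An arm that passed the previous test has gap below 4ε + 2(ε+G) at the previous ε, which is
  -- twice the current one; hence 12. Before any test the gap is at most K = 2K·ε₁.
  have gap : ∀ k, (∀ j < k, G < eps (j + 1)) → ∀ x ∈ (alg.phase z k).2,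
      μ best - μ x ≤ (12 + 2 * K) * (eps (k + 1) + G) := by
    intro k hj x hx
    have hek := eps_pos (k + 1)
    have hKe : 0 ≤ K * (eps (k + 1) + G) := by positivity
    have hKG : 0 ≤ K * G := by positivity
    cases k with
    | zero =>
      have h1 : eps (0 + 1) = 1 / 2 := by norm_num [eps]
      have := hμK best x
      rw [h1] at hKe ⊢
      nlinarith
    | succ k =>
      have hb := survive k fun j hjk => hj j (hjk.trans (Nat.lt_succ_self k))
      obtain ⟨hxV, hx2⟩ := mem_update.1 (show x ∈ alg.update (k + 1) (alg.phase z k).2 _ from hx)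
      have h1 := abs_le.1 (hacc k x hxV)
      have h2 := abs_le.1 (hacc k best hb)
      have h3 := hx2 best hb
      have h4 := eps_succ (k + 1)
      linarith
  refine (sub_le_sub_right (hbest a) _).trans ?_
  have hek := eps_pos (k + 1)
  have hK2 : 0 ≤ K * (eps (k + 1) + G) := by positivity
  -- Otherwise use the first level with ε ≤ G: the gap bound there is at most (12+2K)·2G, and `x`
  -- was already active at that level.
  by_cases hall : ∀ j < k, G < eps (j + 1)
  · have := gap k hall x hx
    linarith
  · push Not at hall
    classical
    have hex : ∃ j, j < k ∧ eps (j + 1) ≤ G := hall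
    obtain ⟨hjk, hjG⟩ := Nat.find_spec hex
    have hmin : ∀ i < Nat.find hex, G < eps (i + 1) := fun i hi => by
      by_contra hcon
      exact Nat.find_min hex hi ⟨hi.trans hjk, not_lt.1 hcon⟩
    have h1 := gap _ hmin x (phase_snd_antitone z hjk.le hx)
    have h2 : (12 + 2 * K) * (eps (Nat.find hex + 1) + G) ≤ (12 + 2 * K) * (2 * G) :=
      mul_le_mul_of_nonneg_left (by linarith) (by positivity)
    nlinarith

end Gap
end RIPSAlg

/-! ### Summing the target accuracies over time. -/

lemma sum_filter_two_pow_le (M : ℝ) (hM : 0 ≤ M) (N : ℕ) :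
    ∑ k ∈ Finset.range N with (2 : ℝ) ^ (k + 1) ≤ M, (2 : ℝ) ^ (k + 1) ≤ 2 * M := by
  have geom : ∀ n : ℕ, ∑ k ∈ Finset.range n, (2 : ℝ) ^ (k + 1) ≤ 2 * 2 ^ n := by
    intro n
    induction n with
    | zero => simp
    | succ n ih => rw [Finset.sum_range_succ, pow_succ]; linarith
  induction N with
  | zero => simpa using hM
  | succ N ih =>
    by_cases h : (2 : ℝ) ^ (N + 1) ≤ M
    · exact (Finset.sum_le_sum_of_subset_of_nonneg (Finset.filter_subset _ _)
        fun _ _ _ => by positivity).trans ((geom (N + 1)).trans (by linarith))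
    · rwa [Finset.range_add_one, Finset.filter_insert, if_neg h]

lemma sum_range_succ_div_two_pow_le (N : ℕ) :
    ∑ k ∈ Finset.range N, ((k : ℝ) + 1) * RIPSAlg.eps (k + 1) ≤ 2 := by
  have : ∑ k ∈ Finset.range N, ((k : ℝ) + 1) * RIPSAlg.eps (k + 1) = 2 - (N + 2) * RIPSAlg.eps N := by
    induction N with
    | zero => simp [RIPSAlg.eps]
    | succ N ih =>
      rw [Finset.sum_range_succ, ih, RIPSAlg.eps_succ N]
      push_cast
      ring
  rw [this]
  have := RIPSAlg.eps_pos N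
  nlinarith [mul_nonneg (Nat.cast_nonneg (α := ℝ) N) this.le]

lemma sum_range_eps_le (N : ℕ) : ∑ k ∈ Finset.range N, RIPSAlg.eps (k + 1) ≤ 1 := by
  have : ∑ k ∈ Finset.range N, RIPSAlg.eps (k + 1) = 1 - RIPSAlg.eps N := by
    induction N with
    | zero => simp [RIPSAlg.eps]
    | succ N ih => rw [Finset.sum_range_succ, ih, RIPSAlg.eps_succ N]; ring
  linarith [RIPSAlg.eps_pos N]

/-- A phase with 2^l ≤ T has l = O(log T), so its confidence level costs only log log T. -/
lemma log_phase_le_log_log {Y T : ℝ} (hY : 2 ≤ Y) (hT : 2 ≤ T) {l : ℕ} (hl : 1 ≤ l)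
    (hlT : (2 : ℝ) ^ l ≤ T) :
    Real.log (4 * (l : ℝ) ^ 2 * Y) ≤ 10 * Real.log (Y * Real.log T) := by
  have l2 := Real.log_two_gt_d9
  have hl1 : (1 : ℝ) ≤ l := by exact_mod_cast hl
  have hlog : l * Real.log 2 ≤ Real.log T := by
    rw [← Real.log_pow]
    exact Real.log_le_log (by positivity) hlT
  have hlT' : Real.log 2 ≤ Real.log T := Real.log_le_log (by norm_num) hT
  have hu : (1.38 : ℝ) ≤ Y * Real.log T := by nlinarith
  have hlY : (l : ℝ) * 1.38 ≤ Y * Real.log T := by nlinarith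
  -- With U = Y log T, l² and Y account for U³ up to the constant 4·0.53·1.5, which U⁷ absorbs since
  -- U ≥ 2 log 2 > 1.38.
  have h1 : 4 * (l : ℝ) ^ 2 * Y ≤ (Y * Real.log T) ^ 10 := by
    set U := Y * Real.log T
    have hYU : Y ≤ 1.5 * U := by
      show Y ≤ 1.5 * (Y * Real.log T)
      nlinarith
    have a1 : (l : ℝ) ^ 2 ≤ U ^ 2 * 0.53 := by nlinarith
    have a2 : (4 : ℝ) * 0.53 * 1.5 ≤ U ^ 7 := by
      calc (4 : ℝ) * 0.53 * 1.5 ≤ 1.38 ^ 7 := by norm_num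
        _ ≤ U ^ 7 := pow_le_pow_left₀ (by norm_num) hu 7
    have hU : 0 ≤ U := by linarith
    calc 4 * (l : ℝ) ^ 2 * Y ≤ 4 * (U ^ 2 * 0.53) * (1.5 * U) := by gcongr
      _ = (4 * 0.53 * 1.5) * U ^ 3 := by ring
      _ ≤ U ^ 7 * U ^ 3 := by gcongr
      _ = U ^ 10 := by ring
  calc _ ≤ Real.log ((Y * Real.log T) ^ 10) := Real.log_le_log (by positivity) h1
    _ = _ := by rw [Real.log_pow]; norm_num

/-- Used for the `q1` part, whose bound must not depend on T: growth linear in the phase is harmless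
because Σ l 2^{-l} converges. -/
lemma log_phase_le {Y : ℝ} (hY : 2 ≤ Y) (k : ℕ) :
    Real.log (4 * ((k + 1 : ℕ) : ℝ) ^ 2 * Y) ≤ Real.log Y + 4 * (k + 1) := by
  have h1 : (4 : ℝ) * ((k + 1 : ℕ) : ℝ) ^ 2 * Y = Y * (2 * ((k : ℝ) + 1)) ^ 2 := by
    push_cast; ring
  rw [h1, Real.log_mul (by positivity) (by positivity), Real.log_pow]
  have := Real.log_le_sub_one_of_pos (show (0 : ℝ) < 2 * ((k : ℝ) + 1) by positivity)
  push_cast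
  linarith

namespace RIPSAlg

variable {α : Type u} [Fintype α]
  {H : Type v} [NormedAddCommGroup H] [InnerProductSpace ℝ H] {alg : RIPSAlg α H}

set_option maxHeartbeats 1000000 in
/-- The target accuracies summed over time, whatever the trajectory. -/
lemma sum_eps_phaseAt_le [Nonempty α] (hA : alg.Admissible) {K : ℝ} (hK : 1 ≤ K * alg.c₁)
    (hY : 2 ≤ Fintype.card α / alg.δ) {T : ℕ} (hT : 2 ≤ T) (z : ℕ → α × ℝ) :
    ∑ t ∈ Finset.range T, eps (alg.phaseAt z t + 1) ≤
      (13 + 4 * K) * (alg.c₁ * Real.log (Fintype.card α / alg.δ)) +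
      81 * (√(maxDesignValue alg.φ alg.γ) * √(alg.c₀ ^ 2 * (alg.σ ^ 2 + alg.B ^ 2) * T *
        Real.log (Fintype.card α * Real.log T / alg.δ))) := by
  set Y : ℝ := Fintype.card α / alg.δ with hYdef
  set f := maxDesignValue alg.φ alg.γ with hf
  have hf0 : 0 ≤ f := (designValue_nonneg alg.φ alg.γ ∅).trans (designValue_le_max _ _ _)
  have hΛdef : (Fintype.card α : ℝ) * Real.log T / alg.δ = Y * Real.log T := by
    rw [hYdef]; ring
  rw [hΛdef]
  set Λ := Real.log (Y * Real.log T) with hΛ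
  have hT' : (2 : ℝ) ≤ T := by exact_mod_cast hT
  have l2 := Real.log_two_gt_d9
  have hΛ0 : 0 ≤ Λ := by
    refine Real.log_nonneg ?_
    have : Real.log 2 ≤ Real.log T := Real.log_le_log (by norm_num) hT'
    nlinarith
  set D := alg.c₀ ^ 2 * (alg.σ ^ 2 + alg.B ^ 2) with hD
  have hD0 : 0 ≤ D := by positivity
  rw [← Real.sqrt_mul hf0]
  set Q := √(f * (D * T * Λ)) with hQ
  have hQ0 : 0 ≤ Q := Real.sqrt_nonneg _
  have hQ2 : Q ^ 2 = f * (D * T * Λ) := Real.sq_sqrt (by positivity)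
  have hlogY : Real.log 2 ≤ Real.log Y := Real.log_le_log (by norm_num) hY
  have hc₁ := hA.c₁_pos
  -- The threshold balances the two kinds of phases. Adding 1 to Q covers the case Q = 0 and gives M
  -- ≤ T, which the log log estimate needs.
  set M := T / (Q + 1) with hM
  have hM0 : 0 < M := by positivity
  have hMT : M ≤ T := div_le_self (by positivity) (by linarith)
  have hTM : T * M⁻¹ = Q + 1 := by rw [hM]; field_simp
  -- phases that are finer than the threshold cost at most the threshold per step
  have step : ∀ t ∈ Finset.range T, eps (alg.phaseAt z t + 1) ≤ M⁻¹ +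
      if (2 : ℝ) ^ (alg.phaseAt z t + 1) ≤ M then eps (alg.phaseAt z t + 1) else 0 := by
    intro t _
    split_ifs with hle
    · have : 0 < M⁻¹ := by positivity
      linarith
    · rw [add_zero]
      exact inv_anti₀ hM0 (not_le.1 hle).le
  have fiber : ∑ t ∈ Finset.range T, (if (2 : ℝ) ^ (alg.phaseAt z t + 1) ≤ M then
      eps (alg.phaseAt z t + 1) else 0) ≤ ∑ k ∈ Finset.range T with (2 : ℝ) ^ (k + 1) ≤ M,
        alg.tau (k + 1) (alg.phase z k).2 * eps (k + 1) := by
    rw [← Finset.sum_fiberwise_of_maps_to (s := Finset.range T) (t := Finset.range T)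
      (g := fun t => alg.phaseAt z t) (fun t ht => Finset.mem_range.2
        ((phaseAt_le z t).trans_lt (Finset.mem_range.1 ht))), Finset.sum_filter]
    refine Finset.sum_le_sum fun k _ => ?_
    have : ∑ t ∈ Finset.range T with alg.phaseAt z t = k,
        (if (2 : ℝ) ^ (alg.phaseAt z t + 1) ≤ M then eps (alg.phaseAt z t + 1) else 0) =
        ((Finset.range T).filter fun t => alg.phaseAt z t = k).card *
          (if (2 : ℝ) ^ (k + 1) ≤ M then eps (k + 1) else 0) := by
      rw [← nsmul_eq_mul, ← Finset.sum_const]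
      exact Finset.sum_congr rfl fun t ht => by rw [(Finset.mem_filter.1 ht).2]
    rw [this]
    split_ifs
    · exact mul_le_mul_of_nonneg_right (by exact_mod_cast card_phaseAt_eq_le hA z T k)
        (eps_pos _).le
    · simp
  have term : ∀ k ∈ (Finset.range T).filter (fun k => (2 : ℝ) ^ (k + 1) ≤ M),
      alg.tau (k + 1) (alg.phase z k).2 * eps (k + 1) ≤
        (alg.c₁ * (Real.log Y * eps (k + 1) + 4 * ((k + 1) * eps (k + 1))) + eps (k + 1)) +
          40 * (D * f * Λ) * 2 ^ (k + 1) := by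
    intro k hk
    have hkM := (Finset.mem_filter.1 hk).2
    have he := eps_pos (k + 1)
    have h1 := tau_le hA (Nat.le_add_left 1 k) (alg.phase z k).2
    have hYk : (4 : ℝ) * ((k + 1 : ℕ) : ℝ) ^ 2 * Fintype.card α / alg.δ =
      4 * ((k + 1 : ℕ) : ℝ) ^ 2 * Y := by rw [hYdef]; ring
    have h2 : alg.q1 (k + 1) ≤ alg.c₁ * (Real.log Y + 4 * (k + 1)) := by
      unfold q1
      rw [hYk]
      exact mul_le_mul_of_nonneg_left (log_phase_le hY k) hc₁.le
    have h3 : alg.q2 (k + 1) (alg.phase z k).2 * eps (k + 1) ≤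
        40 * (D * f * Λ) * 2 ^ (k + 1) := by
      unfold q2
      rw [hYk]
      have e1 : (eps (k + 1) ^ 2)⁻¹ * eps (k + 1) = 2 ^ (k + 1) := by
        unfold eps; field_simp
      have e2 := log_phase_le_log_log hY hT' (Nat.le_add_left 1 k) (hkM.trans hMT)
      have e3 := designValue_le_max alg.φ alg.γ (alg.phase z k).2
      have e4 := designValue_nonneg alg.φ alg.γ (alg.phase z k).2
      have e5 : 0 ≤ Real.log (4 * ((k + 1 : ℕ) : ℝ) ^ 2 * Y) := by
        refine Real.log_nonneg ?_
        have : (1 : ℝ) ≤ ((k + 1 : ℕ) : ℝ) := by exact_mod_cast Nat.le_add_left 1 k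
        nlinarith [one_le_pow₀ (n := 2) this]
      calc _ = 4 * D * (designValue alg.φ alg.γ (alg.phase z k).2 *
            Real.log (4 * ((k + 1 : ℕ) : ℝ) ^ 2 * Y)) * ((eps (k + 1) ^ 2)⁻¹ * eps (k + 1)) := by
            rw [hD]; ring
        _ ≤ 4 * D * (f * (10 * Λ)) * 2 ^ (k + 1) := by
            rw [e1]
            gcongr
        _ = _ := by ring
    calc _ ≤ (alg.q1 (k + 1) + alg.q2 (k + 1) (alg.phase z k).2 + 1) * eps (k + 1) :=
          mul_le_mul_of_nonneg_right h1 he.le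
      _ ≤ _ := by nlinarith [mul_le_mul_of_nonneg_right h2 he.le]
  have nonneg1 : ∀ k : ℕ, 0 ≤ alg.c₁ * (Real.log Y * eps (k + 1) + 4 * ((k + 1) * eps (k + 1)))
      + eps (k + 1) := by
    intro k
    have he := eps_pos (k + 1)
    have : 0 ≤ Real.log Y := by linarith
    positivity
  have sum1 : ∑ k ∈ Finset.range T with (2 : ℝ) ^ (k + 1) ≤ M,
      (alg.c₁ * (Real.log Y * eps (k + 1) + 4 * ((k + 1) * eps (k + 1))) + eps (k + 1)) ≤
      alg.c₁ * (Real.log Y + 8) + 1 := by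
    refine (Finset.sum_le_sum_of_subset_of_nonneg (Finset.filter_subset _ _)
      fun k _ _ => nonneg1 k).trans ?_
    rw [Finset.sum_add_distrib, ← Finset.mul_sum, Finset.sum_add_distrib, ← Finset.mul_sum,
      ← Finset.mul_sum]
    have a1 := sum_range_eps_le T
    have a2 := sum_range_succ_div_two_pow_le T
    have a3 : Real.log Y * ∑ k ∈ Finset.range T, eps (k + 1) ≤ Real.log Y * 1 :=
      mul_le_mul_of_nonneg_left a1 (by linarith)
    have a4 := mul_le_mul_of_nonneg_left (add_le_add a3 (mul_le_mul_of_nonneg_left a2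
      (show (0 : ℝ) ≤ 4 by norm_num))) hc₁.le
    linarith
  have sum2 : ∑ k ∈ Finset.range T with (2 : ℝ) ^ (k + 1) ≤ M,
      40 * (D * f * Λ) * 2 ^ (k + 1) ≤ 80 * Q := by
    rw [← Finset.mul_sum]
    have a1 := sum_filter_two_pow_le M hM0.le T
    -- The left side is (Q²/T)·T/(Q+1).
    have a2 : D * f * Λ * M ≤ Q := by
      have e1 : D * f * Λ * T = Q ^ 2 := by rw [hQ2]; ring
      rw [hM, mul_div_assoc', div_le_iff₀ (by positivity), e1, sq]
      exact mul_le_mul_of_nonneg_left (by linarith) hQ0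
    nlinarith [mul_le_mul_of_nonneg_left a1 (show 0 ≤ D * f * Λ by positivity)]
  calc _ ≤ _ := Finset.sum_le_sum step
    _ = (Q + 1) + _ := by
      rw [Finset.sum_add_distrib, Finset.sum_const, Finset.card_range, nsmul_eq_mul, hTM]
    _ ≤ (Q + 1) + ((alg.c₁ * (Real.log Y + 8) + 1) + 80 * Q) := by
      have h1 := fiber.trans (Finset.sum_le_sum term)
      rw [Finset.sum_add_distrib] at h1
      linarith
    _ ≤ _ := by
      -- log Y ≥ log 2 > 2/3 absorbs the additive 8c₁. The leftover 2 comes from `Q + 1` and from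
      -- rounding τ up; K·c₁ ≥ 1 absorbs it.
      have b1 : 8 * alg.c₁ ≤ 12 * (alg.c₁ * Real.log Y) := by nlinarith
      have b2 : 2 ≤ 4 * K * (alg.c₁ * Real.log Y) := by
        have : (1 : ℝ) * 0.5 ≤ (K * alg.c₁) * Real.log Y :=
          mul_le_mul hK (by linarith) (by norm_num) (by linarith)
        linarith
      linarith

end RIPSAlg

/-! ### Mean and variance of a weighted reward. -/

section RewardLaw

variable {α : Type u} [Fintype α]

/-- The law of `g a * (μ a + e)` when the arm `a` is drawn from `lam` and, independently,
the noise `e` from `ρ`. -/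
def weightedRewardLaw (lam g μ : α → ℝ) (ρ : Measure ℝ) : Measure ℝ :=
  ∑ a, ENNReal.ofReal (lam a) • ρ.map fun e => g a * (μ a + e)

lemma measurable_weighted_reward (c m : ℝ) : Measurable fun e : ℝ => c * (m + e) := by fun_prop

lemma weightedRewardLaw_apply (lam g μ : α → ℝ) (ρ : Measure ℝ) {D : Set ℝ}
    (hD : MeasurableSet D) : weightedRewardLaw lam g μ ρ D =
      ∑ a, ENNReal.ofReal (lam a) * ρ ((fun e => g a * (μ a + e)) ⁻¹' D) := by
  simp [weightedRewardLaw, Measure.map_apply (measurable_weighted_reward _ _) hD]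

lemma isProbabilityMeasure_weightedRewardLaw {lam : α → ℝ} (h0 : ∀ a, 0 ≤ lam a)
    (h1 : ∑ a, lam a = 1) (g μ : α → ℝ) (ρ : Measure ℝ) [IsProbabilityMeasure ρ] :
    IsProbabilityMeasure (weightedRewardLaw lam g μ ρ) := by
  refine ⟨?_⟩
  rw [weightedRewardLaw_apply _ _ _ _ MeasurableSet.univ]
  simp [← ENNReal.ofReal_sum_of_nonneg fun a _ => h0 a, h1]

lemma integrable_weightedRewardLaw (lam g μ : α → ℝ) {ρ : Measure ℝ} {f : ℝ → ℝ}
    (hf : Measurable f) (hint : ∀ a, Integrable (fun e => f (g a * (μ a + e))) ρ) :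
    Integrable f (weightedRewardLaw lam g μ ρ) :=
  integrable_finsetSum_measure.2 fun a _ => Integrable.smul_measure
    ((integrable_map_measure hf.aestronglyMeasurable
      (measurable_weighted_reward _ _).aemeasurable).2 (hint a)) ENNReal.ofReal_ne_top

lemma memLp_weightedRewardLaw (lam g μ : α → ℝ) {ρ : Measure ℝ} [IsProbabilityMeasure ρ]
    (hρ : MemLp (fun r : ℝ => r) 2 ρ) :
    MemLp (fun r : ℝ => r) 2 (weightedRewardLaw lam g μ ρ) :=
  (memLp_two_iff_integrable_sq measurable_id.aestronglyMeasurable).2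
    (integrable_weightedRewardLaw lam g μ (f := fun r => r ^ 2) (by fun_prop) fun a =>
      (((memLp_const (μ a)).add hρ).const_mul (g a)).integrable_sq)

lemma integral_weightedRewardLaw {lam : α → ℝ} (h0 : ∀ a, 0 ≤ lam a) (g μ : α → ℝ)
    {ρ : Measure ℝ} [IsProbabilityMeasure ρ] {f : ℝ → ℝ} (hf : Measurable f)
    (hint : ∀ a, Integrable (fun e => f (g a * (μ a + e))) ρ) :
    ∫ r, f r ∂(weightedRewardLaw lam g μ ρ) = ∑ a, lam a * ∫ e, f (g a * (μ a + e)) ∂ρ := by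
  unfold weightedRewardLaw
  rw [integral_finsetSum_measure]
  · refine Finset.sum_congr rfl fun a _ => ?_
    rw [integral_smul_measure, integral_map (measurable_weighted_reward _ _).aemeasurable
      hf.aestronglyMeasurable, ENNReal.toReal_ofReal (h0 a), smul_eq_mul]
  · intro a _
    refine Integrable.smul_measure ?_ ENNReal.ofReal_ne_top
    exact (integrable_map_measure hf.aestronglyMeasurable
      (measurable_weighted_reward _ _).aemeasurable).2 (hint a)

lemma mean_weightedRewardLaw {lam : α → ℝ} (h0 : ∀ a, 0 ≤ lam a) (g μ : α → ℝ)
    {ρ : Measure ℝ} [IsProbabilityMeasure ρ] (hρ : MemLp (fun r : ℝ => r) 2 ρ)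
    (hmean : ∫ e, e ∂ρ = 0) :
    ∫ r, r ∂(weightedRewardLaw lam g μ ρ) = ∑ a, lam a * (g a * μ a) := by
  have hi : Integrable (fun e : ℝ => e) ρ := hρ.integrable one_le_two
  rw [integral_weightedRewardLaw h0 g μ (f := fun r => r) measurable_id
    fun a => ((integrable_const (μ a)).add hi).const_mul (g a)]
  refine Finset.sum_congr rfl fun a _ => ?_
  rw [integral_const_mul, integral_add (integrable_const _) hi, hmean]
  simp

/-- Bound the variance by the second moment. The noise is centred, so the cross term drops out and
each arm contributes at most B² + σ² times its squared weight. -/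
lemma variance_weightedRewardLaw_le {lam : α → ℝ} (h0 : ∀ a, 0 ≤ lam a) (h1 : ∑ a, lam a = 1)
    (g : α → ℝ) {μ : α → ℝ} {ρ : Measure ℝ} [IsProbabilityMeasure ρ]
    (hρ : MemLp (fun r : ℝ => r) 2 ρ) (hmean : ∫ e, e ∂ρ = 0) {B σ : ℝ}
    (hσ : ∫ e, e ^ 2 ∂ρ ≤ σ ^ 2) (hB : ∀ a, |μ a| ≤ B) :
    Var[fun r : ℝ => r; weightedRewardLaw lam g μ ρ] ≤
      (B ^ 2 + σ ^ 2) * ∑ a, lam a * g a ^ 2 := by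
  have := isProbabilityMeasure_weightedRewardLaw h0 h1 g μ ρ
  have hi : Integrable (fun e : ℝ => e) ρ := hρ.integrable one_le_two
  have hi2 : Integrable (fun e : ℝ => e ^ 2) ρ := hρ.integrable_sq
  refine (variance_le_expectation_sq (by fun_prop)).trans ?_
  have hexp : ∀ a, (fun e : ℝ => (g a * (μ a + e)) ^ 2) =
      fun e => g a ^ 2 * (μ a ^ 2 + 2 * μ a * e + e ^ 2) := fun a => by ext e; ring
  have hint : ∀ a, Integrable (fun e : ℝ => μ a ^ 2 + 2 * μ a * e) ρ := fun a =>
    (integrable_const _).add (hi.const_mul _)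
  have e1 := integral_weightedRewardLaw h0 g μ (ρ := ρ) (f := fun r => r ^ 2) (by fun_prop)
    fun a => by rw [hexp a]; exact ((hint a).add hi2).const_mul _
  have e2 : (∫ r, ((fun r : ℝ => r) ^ 2) r ∂(weightedRewardLaw lam g μ ρ)) =
    ∫ r, r ^ 2 ∂(weightedRewardLaw lam g μ ρ) := rfl
  rw [e2, e1, Finset.mul_sum]
  refine Finset.sum_le_sum fun a _ => ?_
  simp only [hexp]
  rw [integral_const_mul, integral_add (hint a) hi2,
    integral_add (integrable_const _) (hi.const_mul _), integral_const_mul, hmean]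
  have hB2 : μ a ^ 2 ≤ B ^ 2 := sq_le_sq' (abs_le.1 (hB a)).1 (abs_le.1 (hB a)).2
  simp only [integral_const, probReal_univ, mul_zero, add_zero, smul_eq_mul, one_mul]
  calc _ = (lam a * g a ^ 2) * (μ a ^ 2 + ∫ e, e ^ 2 ∂ρ) := by ring
    _ ≤ (lam a * g a ^ 2) * (B ^ 2 + σ ^ 2) :=
      mul_le_mul_of_nonneg_left (add_le_add hB2 hσ) (mul_nonneg (h0 a) (sq_nonneg _))
    _ = _ := by ring

end RewardLaw

/-! ### Measurability of the phases. -/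

namespace RIPSAlg

section Measurability

variable {α : Type u} [Fintype α]
  {H : Type v} [NormedAddCommGroup H] [InnerProductSpace ℝ H] {alg : RIPSAlg α H}

lemma update_congr {l : ℕ} {V : Finset α} {z z' : ℕ → α × ℝ}
    (h : ∀ i < alg.tau l V, z i = z' i) : alg.update l V z = alg.update l V z' := by
  have : alg.robustMeans l V z = alg.robustMeans l V z' := by
    funext x
    unfold robustMeans
    congr 1
    funext i
    rw [h i i.2]
  ext x
  rw [mem_update, mem_update, this]

/-- The first time and the active set of a phase are determined by the trajectory up to then. -/
lemma phase_congr {z z' : ℕ → α × ℝ} {k : ℕ} (h : ∀ i < (alg.phase z k).1, z i = z' i) :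
    alg.phase z' k = alg.phase z k := by
  induction k with
  | zero => rfl
  | succ k ih =>
    have e := ih fun i hi => h i (hi.trans_le (Nat.le_add_right _ _))
    simp only [phase, e]
    congr 1
    exact (update_congr fun i hi => h _ (Nat.add_lt_add_left hi _)).symm

variable [MeasurableSpace α] [MeasurableSingletonClass α]

lemma measurable_robustMeans (hA : alg.Admissible) (l : ℕ) (V : Finset α) :
    Measurable fun z : ℕ → α × ℝ => alg.robustMeans l V z := by
  refine measurable_pi_lambda _ fun x => (hA.measurable_est l _).comp ?_
  refine measurable_pi_lambda _ fun i => ?_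
  have h1 : Measurable fun a : α => invForm alg.φ alg.γ (alg.design l V) (alg.φ x) (alg.φ a) :=
    Measurable.of_discrete
  have h2 : Measurable fun z : ℕ → α × ℝ => z i := measurable_pi_apply _
  exact (h1.comp h2.fst).mul h2.snd

lemma measurableSet_update_eq (hA : alg.Admissible) (l : ℕ) (V V' : Finset α) :
    MeasurableSet {z : ℕ → α × ℝ | alg.update l V z = V'} := by
  have hmem : ∀ x, MeasurableSet {z : ℕ → α × ℝ | x ∈ alg.update l V z} := by
    intro x
    simp only [mem_update]
    have hm := fun y => (hA.measurable_fit l V y).comp (measurable_robustMeans hA l V)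
    have : {z : ℕ → α × ℝ | x ∈ V ∧ ∀ x' ∈ V,
        ⟪alg.fit l V (alg.robustMeans l V z), alg.φ x'⟫
          - ⟪alg.fit l V (alg.robustMeans l V z), alg.φ x⟫ < 4 * eps l} =
        {_z | x ∈ V} ∩ ⋂ x' ∈ V, {z | ⟪alg.fit l V (alg.robustMeans l V z), alg.φ x'⟫
          - ⟪alg.fit l V (alg.robustMeans l V z), alg.φ x⟫ < 4 * eps l} := by
      ext z; simp
    rw [this]
    exact (MeasurableSet.const _).inter (MeasurableSet.iInter fun x' => MeasurableSet.iInter fun _ =>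
      measurableSet_lt ((hm x').sub (hm x)) measurable_const)
  have : {z : ℕ → α × ℝ | alg.update l V z = V'} =
      ⋂ x, {z | x ∈ alg.update l V z ↔ x ∈ V'} := by
    ext z; simp [Finset.ext_iff]
  rw [this]
  refine MeasurableSet.iInter fun x => ?_
  by_cases hx : x ∈ V'
  · simpa [hx] using hmem x
  · simp only [hx, iff_false]
    exact (hmem x).compl

lemma measurableSet_phase_eq (hA : alg.Admissible) (k : ℕ) (p : ℕ × Finset α) :
    MeasurableSet {z : ℕ → α × ℝ | alg.phase z k = p} := by
  induction k generalizing p with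
  | zero => exact MeasurableSet.const ((0, Finset.univ) = p)
  | succ k ih =>
    have : {z : ℕ → α × ℝ | alg.phase z (k + 1) = p} = ⋃ q : ℕ × Finset α,
        {z | alg.phase z k = q} ∩ ({z | q.1 + alg.tau (k + 1) q.2 = p.1} ∩
          {z | alg.update (k + 1) q.2 (fun i => z (q.1 + i)) = p.2}) := by
      ext z
      simp [phase, Prod.ext_iff]
    rw [this]
    refine MeasurableSet.iUnion fun q => (ih q).inter ((MeasurableSet.const _).inter ?_)
    have hs : Measurable fun (z : ℕ → α × ℝ) (i : ℕ) => z (q.1 + i) :=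
      measurable_pi_lambda _ fun i => measurable_pi_apply _
    exact hs (measurableSet_update_eq hA (k + 1) q.2 p.2)

end Measurability

end RIPSAlg

/-! ### The filtration of past arms and rewards. -/

section History

variable {α : Type u} [MeasurableSpace α] {Ω : Type w}

/-- The information in the arms and rewards before time `t`. -/
abbrev history (μ : α → ℝ) (x : ℕ → Ω → α) (ξ : ℕ → Ω → ℝ) (t : ℕ) : MeasurableSpace Ω :=
  MeasurableSpace.comap (fun ω => fun i : Fin t => trajectory μ x ξ ω i) inferInstance

lemma measurable_trajectory_history (μ : α → ℝ) (x : ℕ → Ω → α) (ξ : ℕ → Ω → ℝ) {i t : ℕ}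
    (hi : i < t) : Measurable[history μ x ξ t] fun ω => trajectory μ x ξ ω i :=
  (measurable_pi_apply (⟨i, hi⟩ : Fin t)).comp
    (comap_measurable fun ω => fun i : Fin t => trajectory μ x ξ ω i)

lemma history_mono (μ : α → ℝ) (x : ℕ → Ω → α) (ξ : ℕ → Ω → ℝ) : Monotone (history μ x ξ) := by
  intro s t hst
  refine Measurable.comap_le ?_
  exact @measurable_pi_lambda _ _ _ (history μ x ξ t) _ _ fun i =>
    measurable_trajectory_history μ x ξ (i.2.trans_le hst)

variable [Fintype α] [MeasurableSingletonClass α]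

/-- The start of a phase is a stopping time: by `phase_congr`, padding the first `p.1` observations
with arbitrary values does not affect the event. -/
lemma measurableSet_history_phase_eq [Nonempty α] {H : Type v} [NormedAddCommGroup H]
    [InnerProductSpace ℝ H] {alg : RIPSAlg α H} (hA : alg.Admissible) (μ : α → ℝ)
    (x : ℕ → Ω → α) (ξ : ℕ → Ω → ℝ) (k : ℕ) (p : ℕ × Finset α) :
    MeasurableSet[history μ x ξ p.1] {ω | alg.phase (trajectory μ x ξ ω) k = p} := by
  let ext : (Fin p.1 → α × ℝ) → ℕ → α × ℝ := fun u i =>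
    if h : i < p.1 then u ⟨i, h⟩ else (Classical.arbitrary α, 0)
  have hext : Measurable ext := by
    refine measurable_pi_lambda _ fun i => ?_
    by_cases h : i < p.1
    · simpa [ext, h] using measurable_pi_apply (⟨i, h⟩ : Fin p.1)
    · simp [ext, h]
  refine ⟨_, hext (RIPSAlg.measurableSet_phase_eq hA k p), ?_⟩
  ext ω
  have hagree : ∀ i < p.1, ext (fun i : Fin p.1 => trajectory μ x ξ ω i) i =
      trajectory μ x ξ ω i := fun i hi => by simp [ext, hi]
  simp only [Set.mem_preimage, Set.mem_ofPred_eq]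
  constructor
  · intro h
    exact (RIPSAlg.phase_congr fun i hi => hagree i (by rwa [h] at hi)).trans h
  · intro h
    exact (RIPSAlg.phase_congr fun i hi => (hagree i (by rwa [h] at hi)).symm).trans h

end History

/-! ### Conditional law of one weighted reward. -/

section OneStep

variable {α : Type u} [Fintype α] [MeasurableSpace α] [MeasurableSingletonClass α]
  {Ω : Type w} [MeasurableSpace Ω] {P : Measure Ω} [IsProbabilityMeasure P]
  {H : Type v} [NormedAddCommGroup H] [InnerProductSpace ℝ H] {alg : RIPSAlg α H}
  {μ : α → ℝ} {x : ℕ → Ω → α} {ξ : ℕ → Ω → ℝ} {σ : ℝ}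

lemma measurable_trajectory (hx : ∀ t, Measurable (x t)) (hξ : ∀ t, Measurable (ξ t)) (t : ℕ) :
    Measurable fun ω => trajectory μ x ξ ω t := by
  have : Measurable μ := Measurable.of_discrete
  exact (hx t).prodMk ((this.comp (hx t)).add (hξ t))

lemma history_le (hx : ∀ t, Measurable (x t)) (hξ : ∀ t, Measurable (ξ t)) (t : ℕ) :
    history μ x ξ t ≤ ‹MeasurableSpace Ω› :=
  Measurable.comap_le (measurable_pi_lambda _ fun i : Fin t => measurable_trajectory hx hξ i)

lemma measure_inter_arm_eq (hN : IsNoise P σ x ξ) (hP : IsPlayedBy alg P μ x ξ) {t : ℕ}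
    {lam : α → ℝ} (h0 : ∀ a, 0 ≤ lam a) {G : Set Ω} (hG : MeasurableSet[history μ x ξ t] G)
    (hlam : ∀ ω ∈ G, alg.playProb (trajectory μ x ξ ω) t = lam) (a : α) :
    P (G ∩ {ω | x t ω = a}) = ENNReal.ofReal (lam a) * P G := by
  have hle := history_le (μ := μ) hP.measurable hN.measurable t
  have hG' : MeasurableSet G := hle _ hG
  have hxa : MeasurableSet {ω | x t ω = a} := hP.measurable t (measurableSet_singleton a)
  have h1 := setIntegral_condExp hle (μ := P)
    (f := Set.indicator {ω | x t ω = a} (fun _ => (1 : ℝ)))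
    ((integrable_const 1).indicator hxa) hG
  have h2 : ∫ ω in G, (P[Set.indicator {ω | x t ω = a} (fun _ => (1 : ℝ)) | history μ x ξ t]) ω ∂P
      = ∫ _ in G, lam a ∂P := by
    refine setIntegral_congr_ae hG' ?_
    filter_upwards [hP.law t a] with ω hω hωG
    rw [← hlam ω hωG]
    exact hω
  rw [h2, setIntegral_indicator hxa] at h1
  simp only [setIntegral_const, smul_eq_mul, mul_one] at h1
  rw [← ENNReal.ofReal_toReal (measure_ne_top P (G ∩ _)), ← ENNReal.ofReal_toReal (measure_ne_top P G),
    ← ENNReal.ofReal_mul (h0 a), mul_comm]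
  exact congrArg _ h1.symm

/-- A weighted reward is, given the history, distributed according to the sampling design. -/
lemma measure_inter_weighted_reward (hN : IsNoise P σ x ξ) (hP : IsPlayedBy alg P μ x ξ) {t : ℕ}
    {lam : α → ℝ} (h0 : ∀ a, 0 ≤ lam a) {G : Set Ω} (hG : MeasurableSet[history μ x ξ t] G)
    (hlam : ∀ ω ∈ G, alg.playProb (trajectory μ x ξ ω) t = lam) (g : α → ℝ) {D : Set ℝ}
    (hD : MeasurableSet D) :
    P (G ∩ {ω | g (x t ω) * (μ (x t ω) + ξ t ω) ∈ D}) =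
      P G * weightedRewardLaw lam g μ (P.map (ξ t)) D := by
  have hle := history_le (μ := μ) hP.measurable hN.measurable t
  have hxa : ∀ a, MeasurableSet {ω | x t ω = a} := fun a =>
    hP.measurable t (measurableSet_singleton a)
  -- Once the current arm is fixed, the reward event concerns `ξ t` alone, which is independent of
  -- the history and of that arm.
  have split : P (G ∩ {ω | g (x t ω) * (μ (x t ω) + ξ t ω) ∈ D}) =
      ∑ a, P ((G ∩ {ω | x t ω = a}) ∩ ξ t ⁻¹' ((fun e => g a * (μ a + e)) ⁻¹' D)) := by
    have h1 := sum_measure_preimage_singleton (μ := P.restrict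
      (G ∩ {ω | g (x t ω) * (μ (x t ω) + ξ t ω) ∈ D})) (f := x t) Finset.univ
      (fun a _ => hxa a)
    simp only [Finset.coe_univ, Set.preimage_univ, Measure.restrict_apply_univ] at h1
    rw [← h1]
    refine Finset.sum_congr rfl fun a _ => ?_
    rw [Measure.restrict_apply (hP.measurable t (measurableSet_singleton a))]
    congr 1
    ext ω
    simp only [Set.mem_inter_iff, Set.mem_preimage, Set.mem_singleton_iff, Set.mem_ofPred_eq]
    constructor
    · rintro ⟨rfl, h2, h3⟩; exact ⟨⟨h2, rfl⟩, h3⟩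
    · rintro ⟨⟨h2, rfl⟩, h3⟩; exact ⟨rfl, h2, h3⟩
  rw [split, weightedRewardLaw_apply _ _ _ _ hD, Finset.mul_sum]
  refine Finset.sum_congr rfl fun a _ => ?_
  have hD' := measurable_weighted_reward (g a) (μ a) hD
  rw [Measure.map_apply (hN.measurable t) hD', ← mul_assoc, mul_comm (P G),
    ← measure_inter_arm_eq hN hP h0 hG hlam a]
  obtain ⟨S, hS, rfl⟩ := hG
  -- both the history and the current arm are functions of the arms so far and the earlier noise
  let F : (Fin (t + 1) → α) × (Fin t → ℝ) → (Fin t → α × ℝ) := fun q i =>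
    (q.1 i.castSucc, μ (q.1 i.castSucc) + q.2 i)
  have hF : Measurable F := by
    have hμ : Measurable μ := Measurable.of_discrete
    refine measurable_pi_lambda _ fun i => ?_
    have h1 : Measurable fun q : (Fin (t + 1) → α) × (Fin t → ℝ) => q.1 i.castSucc :=
      (measurable_pi_apply _).comp measurable_fst
    have h2 : Measurable fun q : (Fin (t + 1) → α) × (Fin t → ℝ) => q.2 i :=
      (measurable_pi_apply _).comp measurable_snd
    exact h1.prodMk ((hμ.comp h1).add h2)
  have hlast : Measurable fun q : (Fin (t + 1) → α) × (Fin t → ℝ) => q.1 (Fin.last t) :=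
    (measurable_pi_apply _).comp measurable_fst
  have hind := (hN.indep t).measure_inter_preimage_eq_mul _ _ hD'
    ((hF hS).inter (hlast (measurableSet_singleton a)))
  rw [Set.inter_comm, mul_comm]
  exact hind

end OneStep

namespace RIPSAlg

lemma sum_phaseConf_le {α : Type u} [Fintype α] [Nonempty α] {H : Type v}
    [NormedAddCommGroup H] [InnerProductSpace ℝ H] {alg : RIPSAlg α H} (hA : alg.Admissible) (N : ℕ) :
    ∑ k ∈ Finset.range N, Fintype.card α * alg.phaseConf (k + 1) ≤ alg.δ := by
  have hδ := hA.δ_pos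
  have hc : (0 : ℝ) < Fintype.card α := by exact_mod_cast Fintype.card_pos
  -- Strengthened for induction: 1/(4l²) ≤ 1/(l(l+1)) telescopes.
  have : ∑ k ∈ Finset.range N, Fintype.card α * alg.phaseConf (k + 1) ≤
      alg.δ * (1 - 1 / (N + 1)) := by
    induction N with
    | zero => simp
    | succ N ih =>
      rw [Finset.sum_range_succ]
      refine (add_le_add_left ih _).trans ?_
      have e : (Fintype.card α : ℝ) * alg.phaseConf (N + 1) = alg.δ * (1 / (4 * (N + 1) ^ 2)) := by
        unfold phaseConf
        push_cast
        field_simp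
      rw [e, ← mul_add]
      refine mul_le_mul_of_nonneg_left ?_ hδ.le
      have : (1 : ℝ) / (4 * (N + 1) ^ 2) ≤ 1 / ((N + 1) * (N + 2)) := by
        apply one_div_le_one_div_of_le (by positivity)
        nlinarith [Nat.cast_nonneg (α := ℝ) N]
      have e2 : (1 : ℝ) / ((N + 1) * (N + 2)) = 1 / (N + 1) - 1 / (N + 1 + 1) := by
        field_simp
        ring
      push_cast
      linarith
  refine this.trans ?_
  have : 0 ≤ alg.δ * (1 / ((N : ℝ) + 1)) := by positivity
  linarith

end RIPSAlg

/-! ### Independence within a phase and the union bound. -/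

section Block

variable {α : Type u} [Fintype α] [MeasurableSpace α] [MeasurableSingletonClass α]
  {Ω : Type w} [MeasurableSpace Ω] {P : Measure Ω} [IsProbabilityMeasure P]
  {H : Type v} [NormedAddCommGroup H] [InnerProductSpace ℝ H] {alg : RIPSAlg α H}
  {μ : α → ℝ} {x : ℕ → Ω → α} {ξ : ℕ → Ω → ℝ} {σ : ℝ}

/-- The product formula on rectangles: the event about the first m rewards lies in the history at
time s + m, so the one-step law peels off the last factor. -/
lemma measure_inter_forall_weighted_reward (hN : IsNoise P σ x ξ) (hP : IsPlayedBy alg P μ x ξ)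
    {s n : ℕ} {lam : α → ℝ} (h0 : ∀ a, 0 ≤ lam a) {A : Set Ω}
    (hA : MeasurableSet[history μ x ξ s] A)
    (hlam : ∀ ω ∈ A, ∀ i < n, alg.playProb (trajectory μ x ξ ω) (s + i) = lam) (g : α → ℝ)
    {D : ℕ → Set ℝ} (hD : ∀ i, MeasurableSet (D i)) {m : ℕ} (hm : m ≤ n) :
    P (A ∩ {ω | ∀ i < m, g (x (s + i) ω) * (μ (x (s + i) ω) + ξ (s + i) ω) ∈ D i}) =
      P A * ∏ i ∈ Finset.range m, weightedRewardLaw lam g μ (P.map (ξ (s + i))) (D i) := by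
  have hg : Measurable fun q : α × ℝ => g q.1 * q.2 :=
    ((Measurable.of_discrete (f := g)).comp measurable_fst).mul measurable_snd
  induction m with
  | zero => simp
  | succ m ih =>
    have hmeas : MeasurableSet[history μ x ξ (s + m)]
        (A ∩ {ω | ∀ i < m, g (x (s + i) ω) * (μ (x (s + i) ω) + ξ (s + i) ω) ∈ D i}) := by
      have : {ω | ∀ i < m, g (x (s + i) ω) * (μ (x (s + i) ω) + ξ (s + i) ω) ∈ D i} =
          ⋂ i, ⋂ (_ : i < m), (fun ω => trajectory μ x ξ ω (s + i)) ⁻¹'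
            ((fun q : α × ℝ => g q.1 * q.2) ⁻¹' D i) := by
        ext ω; simp [trajectory]
      rw [this]
      refine (history_mono μ x ξ (Nat.le_add_right s m) _ hA).inter ?_
      exact MeasurableSet.iInter fun i => MeasurableSet.iInter fun hi =>
        measurable_trajectory_history μ x ξ (Nat.add_lt_add_left hi s) (hg (hD i))
    have hsplit : A ∩ {ω | ∀ i < m + 1, g (x (s + i) ω) * (μ (x (s + i) ω) + ξ (s + i) ω) ∈ D i} =
        (A ∩ {ω | ∀ i < m, g (x (s + i) ω) * (μ (x (s + i) ω) + ξ (s + i) ω) ∈ D i}) ∩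
          {ω | g (x (s + m) ω) * (μ (x (s + m) ω) + ξ (s + m) ω) ∈ D m} := by
      ext ω
      simp only [Set.mem_inter_iff, Set.mem_ofPred_eq, Nat.lt_succ_iff_lt_or_eq, or_imp,
        forall_and, forall_eq, and_assoc]
    rw [hsplit, measure_inter_weighted_reward hN hP h0 hmeas
      (fun ω hω => hlam ω hω.1 m hm) g (hD m), ih (Nat.le_of_succ_le hm), Finset.prod_range_succ,
      mul_assoc]

/-- On an event of the history at time `s` on which the sampling design stays the same until time
`s + n`, the weighted rewards of this time span are independent. -/
lemma measure_inter_weighted_rewards_mem (hN : IsNoise P σ x ξ) (hP : IsPlayedBy alg P μ x ξ)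
    {s n : ℕ} {lam : α → ℝ} (h0 : ∀ a, 0 ≤ lam a) (h1 : ∑ a, lam a = 1) {A : Set Ω}
    (hA : MeasurableSet[history μ x ξ s] A)
    (hlam : ∀ ω ∈ A, ∀ i < n, alg.playProb (trajectory μ x ξ ω) (s + i) = lam) (g : α → ℝ)
    {S : Set (Fin n → ℝ)} (hS : MeasurableSet S) :
    P (A ∩ {ω | (fun i : Fin n => g (x (s + i) ω) * (μ (x (s + i) ω) + ξ (s + i) ω)) ∈ S}) =
      P A * Measure.pi (fun i : Fin n => weightedRewardLaw lam g μ (P.map (ξ (s + i)))) S := by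
  have hprob : ∀ i : Fin n,
      IsProbabilityMeasure (weightedRewardLaw lam g μ (P.map (ξ (s + i)))) := fun i =>
    have := Measure.isProbabilityMeasure_map (μ := P) (hN.measurable (s + i)).aemeasurable
    isProbabilityMeasure_weightedRewardLaw h0 h1 g μ _
  by_cases hA0 : P A = 0
  · rw [hA0, zero_mul]
    exact measure_mono_null Set.inter_subset_left hA0
  have hAm : MeasurableSet A := history_le hP.measurable hN.measurable s _ hA
  have hR : Measurable fun ω => fun i : Fin n =>
      g (x (s + i) ω) * (μ (x (s + i) ω) + ξ (s + i) ω) := by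
    refine measurable_pi_lambda _ fun i => ?_
    have := measurable_trajectory (μ := μ) hP.measurable hN.measurable (s + i)
    exact ((Measurable.of_discrete (f := g)).comp this.fst).mul this.snd
  have key : Measure.pi (fun i : Fin n => weightedRewardLaw lam g μ (P.map (ξ (s + i)))) =
      ((P A)⁻¹ • P.restrict A).map fun ω => fun i : Fin n =>
        g (x (s + i) ω) * (μ (x (s + i) ω) + ξ (s + i) ω) := by
    refine Measure.pi_eq fun D hD => ?_
    rw [Measure.map_apply hR (MeasurableSet.univ_pi hD), Measure.smul_apply,
      Measure.restrict_apply (hR (MeasurableSet.univ_pi hD)), Set.inter_comm, smul_eq_mul]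
    have e := measure_inter_forall_weighted_reward hN hP h0 hA hlam g
      (D := fun i => if h : i < n then D ⟨i, h⟩ else Set.univ)
      (fun i => by split_ifs; exacts [hD _, MeasurableSet.univ]) le_rfl
    have e1 : A ∩ (fun ω => fun i : Fin n =>
        g (x (s + i) ω) * (μ (x (s + i) ω) + ξ (s + i) ω)) ⁻¹' Set.univ.pi D =
        A ∩ {ω | ∀ i < n, g (x (s + i) ω) * (μ (x (s + i) ω) + ξ (s + i) ω) ∈
          (if h : i < n then D ⟨i, h⟩ else Set.univ)} := by
      ext ω
      simp only [Set.mem_inter_iff, Set.mem_preimage, Set.mem_univ_pi, Set.mem_ofPred_eq]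
      refine and_congr_right fun _ => ⟨fun h i hi => ?_, fun h i => ?_⟩
      · simpa [hi] using h ⟨i, hi⟩
      · simpa using h i i.2
    rw [e1, e, ← mul_assoc, ENNReal.inv_mul_cancel hA0 (measure_ne_top _ _), one_mul,
      Finset.prod_range]
    simp
  rw [key, Measure.map_apply hR hS, Measure.smul_apply, Measure.restrict_apply (hR hS),
    smul_eq_mul, ← mul_assoc, ENNReal.mul_inv_cancel hA0 (measure_ne_top _ _), one_mul,
    Set.inter_comm]
  rfl

variable [Nonempty α]

/-- Almost surely, all arms that are played are active. -/
lemma ae_forall_mem_active (hA : alg.Admissible) (hN : IsNoise P σ x ξ)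
    (hP : IsPlayedBy alg P μ x ξ) :
    ∀ᵐ ω ∂P, ∀ t, x t ω ∈
      (alg.phase (trajectory μ x ξ ω) (alg.phaseAt (trajectory μ x ξ ω) t)).2 := by
  -- Fixing time, phase data and arm leaves countably many events, each null because the design
  -- vanishes off the active set.
  have key : ∀ᵐ ω ∂P, ∀ (t k : ℕ) (p : ℕ × Finset α) (a : α), p.1 ≤ t →
      t < p.1 + alg.tau (k + 1) p.2 → a ∉ p.2 →
      ¬ (alg.phase (trajectory μ x ξ ω) k = p ∧ x t ω = a) := by
    simp only [ae_all_iff]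
    intro t k p a h1 h2 ha
    have hG : MeasurableSet[history μ x ξ t] {ω | alg.phase (trajectory μ x ξ ω) k = p} :=
      history_mono μ x ξ h1 _ (measurableSet_history_phase_eq hA μ x ξ k p)
    rcases p.2.eq_empty_or_nonempty with hV | hV
    · refine Filter.Eventually.of_forall fun ω hω => ?_
      have := RIPSAlg.phase_snd_nonempty (alg := alg) (trajectory μ x ξ ω) k
      rw [hω.1, hV] at this
      exact Finset.not_nonempty_empty this
    · obtain ⟨h0, hsupp, -⟩ := hA.design_mem (k + 1) p.2 hV
      have h3 := measure_inter_arm_eq hN hP h0 hG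
        (fun ω hω => RIPSAlg.playProb_eq hA (s := p.1) (V := p.2) hω h1 h2) a
      rw [hsupp a ha, ENNReal.ofReal_zero, zero_mul] at h3
      exact measure_eq_zero_iff_ae_notMem.1 h3
  filter_upwards [key] with ω hω t
  by_contra hcon
  exact hω t _ _ _ (RIPSAlg.phase_phaseAt_le _ t) (RIPSAlg.lt_phase_phaseAt_succ hA _ t) hcon
    ⟨rfl, rfl⟩

variable [CompleteSpace H]

/-- In a given phase with a given active set, the robust mean of an arm is inaccurate with
probability at most `phaseConf`. -/
lemma measure_inter_not_accurate_le (hA : alg.Admissible) (hB : ∀ a, |μ a| ≤ alg.B)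
    (hN : IsNoise P alg.σ x ξ) (hP : IsPlayedBy alg P μ x ξ)
    (hrob : ((∀ s t, IdentDistrib (ξ s) (ξ t) P P) ∧
        (∀ l : ℕ, 1 ≤ l → IsRobust alg.c₀ alg.c₁ (alg.phaseConf l) (alg.est l)) ∨
      (∀ l : ℕ, 1 ≤ l → IsRobustIndep alg.c₀ alg.c₁ (alg.phaseConf l) (alg.est l))))
    (k : ℕ) (p : ℕ × Finset α) (y : α) :
    P {ω | alg.phase (trajectory μ x ξ ω) k = p ∧ y ∈ p.2 ∧
      ¬ |alg.robustMeans (k + 1) p.2 (fun i => trajectory μ x ξ ω (p.1 + i)) y -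
      ∑ a, alg.design (k + 1) p.2 a *
        (invForm alg.φ alg.γ (alg.design (k + 1) p.2) (alg.φ y) (alg.φ a) * μ a)| ≤
    alg.c₀ * √((alg.B ^ 2 + alg.σ ^ 2) *
      invNorm alg.φ alg.γ (alg.design (k + 1) p.2) (alg.φ y) ^ 2 *
        Real.log (1 / alg.phaseConf (k + 1)) / alg.tau (k + 1) p.2)} ≤
    ENNReal.ofReal (alg.phaseConf (k + 1)) *
      P {ω | alg.phase (trajectory μ x ξ ω) k = p} := by
  obtain ⟨s, V⟩ := p
  simp only
  by_cases hy : y ∈ V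
  swap
  · simp [hy]
  have hl : 1 ≤ k + 1 := Nat.le_add_left 1 k
  obtain ⟨h0, -, h1⟩ := hA.design_mem (k + 1) V ⟨y, hy⟩
  set lam := alg.design (k + 1) V with hlamdef
  set g : α → ℝ := fun a => invForm alg.φ alg.γ lam (alg.φ y) (alg.φ a) with hg
  set n := alg.tau (k + 1) V with hn
  set m := ∑ a, lam a * (g a * μ a) with hm
  set s2 := (alg.B ^ 2 + alg.σ ^ 2) * invNorm alg.φ alg.γ lam (alg.φ y) ^ 2 with hs2
  set L := Real.log (1 / alg.phaseConf (k + 1)) with hL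
  set A := {ω | alg.phase (trajectory μ x ξ ω) k = (s, V)} with hAdef
  set ν : Fin n → Measure ℝ := fun i => weightedRewardLaw lam g μ (P.map (ξ (s + i))) with hν
  have hs20 : 0 ≤ s2 := by positivity
  have hρprob : ∀ t, IsProbabilityMeasure (P.map (ξ t)) := fun t =>
    Measure.isProbabilityMeasure_map (hN.measurable t).aemeasurable
  have hρL2 : ∀ t, MemLp (fun r : ℝ => r) 2 (P.map (ξ t)) := fun t =>
    (memLp_map_measure_iff (by fun_prop) (hN.measurable t).aemeasurable).2 (hN.memLp t)
  have hρmean : ∀ t, ∫ e, e ∂(P.map (ξ t)) = 0 := fun t => by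
    rw [integral_map (hN.measurable t).aemeasurable (by fun_prop)]
    exact hN.mean_zero t
  have hρsq : ∀ t, ∫ e, e ^ 2 ∂(P.map (ξ t)) ≤ alg.σ ^ 2 := fun t => by
    rw [integral_map (hN.measurable t).aemeasurable (by fun_prop)]
    exact hN.second_moment t
  have hνprob : ∀ i, IsProbabilityMeasure (ν i) := fun i =>
    isProbabilityMeasure_weightedRewardLaw h0 h1 g μ _
  have hνL2 : ∀ i, MemLp (fun r : ℝ => r) 2 (ν i) := fun i =>
    memLp_weightedRewardLaw lam g μ (hρL2 _)
  have hνmean : ∀ i, ∫ r, r ∂(ν i) = m := fun i =>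
    mean_weightedRewardLaw h0 g μ (hρL2 _) (hρmean _)
  have hνvar : ∀ i, Var[fun r : ℝ => r; ν i] ≤ s2 := fun i =>
    (variance_weightedRewardLaw_le h0 h1 g (hρL2 _) (hρmean _) (hρsq _) hB).trans
      (mul_le_mul_of_nonneg_left (sum_mul_sq_invForm_le alg.φ hA.γ_pos h0 _) (by positivity))
  have hq : alg.c₁ * L ≤ n := by
    have := RIPSAlg.q1_le_tau (alg := alg) (k + 1) V
    rwa [RIPSAlg.q1, ← RIPSAlg.inv_phaseConf] at this
  have hL0 : 0 ≤ L := by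
    rw [hL, RIPSAlg.inv_phaseConf]
    exact (RIPSAlg.log_inv_phaseConf_pos hA hl).le
  set good : Set (Fin n → ℝ) := {r | |alg.est (k + 1) n r - m| ≤ alg.c₀ * √(s2 * L / n)} with hgood
  have hgoodm : MeasurableSet good :=
    measurableSet_le ((hA.measurable_est (k + 1) n).sub_const m).norm measurable_const
  have hrobust : 1 - alg.phaseConf (k + 1) ≤ (Measure.pi ν).real good := by
    -- Identically distributed noise makes all `ν i` equal, so the i.i.d. guarantee applies, with
    -- the true variance then enlarged to `s2`.
    rcases hrob with ⟨hid, hr⟩ | hr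
    · have hn0 : 0 < n := RIPSAlg.tau_pos hA hl V
      have hconst : ν = fun _ => ν ⟨0, hn0⟩ := by
        funext i
        simp only [hν]
        rw [(hid (s + i) (s + (⟨0, hn0⟩ : Fin n))).map_eq]
      have h2 := hr (k + 1) hl n (ν ⟨0, hn0⟩) hq (hνL2 _)
      rw [← hconst, hνmean] at h2
      refine h2.trans (measureReal_mono fun r hr => ?_)
      refine le_trans (show _ ≤ _ from hr) (mul_le_mul_of_nonneg_left (Real.sqrt_le_sqrt ?_)
        hA.c₀_pos.le)
      gcongr
      exact hνvar _
    · exact hr (k + 1) hl n ν m s2 hq hs20 hνL2 hνmean hνvar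
  have hbad : Measure.pi ν goodᶜ ≤ ENNReal.ofReal (alg.phaseConf (k + 1)) := by
    rw [← ENNReal.ofReal_toReal (measure_ne_top (Measure.pi ν) goodᶜ)]
    refine ENNReal.ofReal_le_ofReal ?_
    have := probReal_compl_eq_one_sub (μ := Measure.pi ν) hgoodm
    rw [measureReal_def] at this
    linarith
  have hplay : ∀ ω ∈ A, ∀ i < n, alg.playProb (trajectory μ x ξ ω) (s + i) = lam :=
    fun ω hω i hi => RIPSAlg.playProb_eq hA hω (Nat.le_add_right s i) (Nat.add_lt_add_left hi s)
  have hfin := measure_inter_weighted_rewards_mem hN hP h0 h1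
    (measurableSet_history_phase_eq hA μ x ξ k (s, V)) hplay g hgoodm.compl
  calc _ = P (A ∩ {ω | (fun i : Fin n => g (x (s + i) ω) * (μ (x (s + i) ω) + ξ (s + i) ω)) ∈
        goodᶜ}) := by
        congr 1
        ext ω
        refine and_congr_right fun _ => ?_
        simp only [hy, true_and]
        rfl
    _ = P A * Measure.pi ν goodᶜ := hfin
    _ ≤ _ := by rw [mul_comm]; gcongr

/-- With probability at least `1 - δ`, the robust means of all phases are accurate. -/
lemma one_sub_le_measure_accurate (hA : alg.Admissible) (hB : ∀ a, |μ a| ≤ alg.B)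
    (hN : IsNoise P alg.σ x ξ) (hP : IsPlayedBy alg P μ x ξ)
    (hrob : ((∀ s t, IdentDistrib (ξ s) (ξ t) P P) ∧
        (∀ l : ℕ, 1 ≤ l → IsRobust alg.c₀ alg.c₁ (alg.phaseConf l) (alg.est l)) ∨
      (∀ l : ℕ, 1 ≤ l → IsRobustIndep alg.c₀ alg.c₁ (alg.phaseConf l) (alg.est l)))) :
    1 - alg.δ ≤ P.real {ω | ∀ k, alg.MeansAccurate μ (k + 1)
      (alg.phase (trajectory μ x ξ ω) k).2
      fun i => trajectory μ x ξ ω ((alg.phase (trajectory μ x ξ ω) k).1 + i)} := by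
  set good := {ω | ∀ k, alg.MeansAccurate μ (k + 1) (alg.phase (trajectory μ x ξ ω) k).2
      fun i => trajectory μ x ξ ω ((alg.phase (trajectory μ x ξ ω) k).1 + i)} with hgood
  set bad : ℕ → ℕ × Finset α → α → Set Ω := fun k p y =>
    {ω | alg.phase (trajectory μ x ξ ω) k = p ∧ y ∈ p.2 ∧
      ¬ |alg.robustMeans (k + 1) p.2 (fun i => trajectory μ x ξ ω (p.1 + i)) y -
      ∑ a, alg.design (k + 1) p.2 a *
        (invForm alg.φ alg.γ (alg.design (k + 1) p.2) (alg.φ y) (alg.φ a) * μ a)| ≤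
    alg.c₀ * √((alg.B ^ 2 + alg.σ ^ 2) *
      invNorm alg.φ alg.γ (alg.design (k + 1) p.2) (alg.φ y) ^ 2 *
        Real.log (1 / alg.phaseConf (k + 1)) / alg.tau (k + 1) p.2)} with hbad
  have hsub : goodᶜ ⊆ ⋃ k, ⋃ p, ⋃ y, bad k p y := by
    intro ω hω
    have h1 : ∃ k, ¬ alg.MeansAccurate μ (k + 1) (alg.phase (trajectory μ x ξ ω) k).2
      fun i => trajectory μ x ξ ω ((alg.phase (trajectory μ x ξ ω) k).1 + i) :=
      not_forall.1 hω
    obtain ⟨k, hk⟩ := h1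
    unfold RIPSAlg.MeansAccurate at hk
    push Not at hk
    obtain ⟨y, hy, hy2⟩ := hk
    simp only [Set.mem_iUnion]
    exact ⟨k, _, y, rfl, hy, not_le.2 hy2⟩
  -- Disjointness makes the union over start times and active sets free of charge.
  have hphase : ∀ k, ∑' p : ℕ × Finset α, P {ω | alg.phase (trajectory μ x ξ ω) k = p} ≤ 1 := by
    intro k
    refine (tsum_measure_le_measure_univ (fun p => ?_) fun p q hpq => ?_).trans_eq measure_univ
    · exact (history_le hP.measurable hN.measurable p.1 _
        (measurableSet_history_phase_eq hA μ x ξ k p)).nullMeasurableSet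
    · refine Disjoint.aedisjoint (Set.disjoint_left.2 fun ω h1 h2 => hpq ?_)
      exact (show _ = p from h1).symm.trans h2
  have hbound : P goodᶜ ≤ ENNReal.ofReal alg.δ := by
    calc P goodᶜ ≤ P (⋃ k, ⋃ p, ⋃ y, bad k p y) := measure_mono hsub
      _ ≤ ∑' k, ∑' p, ∑ y, P (bad k p y) := by
          refine (measure_iUnion_le _).trans (ENNReal.tsum_le_tsum fun k => ?_)
          refine (measure_iUnion_le _).trans (ENNReal.tsum_le_tsum fun p => ?_)
          exact measure_iUnion_fintype_le _ _
      _ ≤ ∑' k, ∑' p : ℕ × Finset α, ENNReal.ofReal (Fintype.card α * alg.phaseConf (k + 1)) *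
            P {ω | alg.phase (trajectory μ x ξ ω) k = p} := by
          refine ENNReal.tsum_le_tsum fun k => ENNReal.tsum_le_tsum fun p => ?_
          refine (Finset.sum_le_sum fun y _ =>
            measure_inter_not_accurate_le hA hB hN hP hrob k p y).trans_eq ?_
          rw [Finset.sum_const, Finset.card_univ, nsmul_eq_mul,
            ENNReal.ofReal_mul (Nat.cast_nonneg _), ENNReal.ofReal_natCast, mul_assoc]
      _ ≤ ∑' k, ENNReal.ofReal (Fintype.card α * alg.phaseConf (k + 1)) := by
          refine ENNReal.tsum_le_tsum fun k => ?_
          rw [ENNReal.tsum_mul_left]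
          exact mul_le_of_le_one_right (zero_le) (hphase k)
      _ ≤ ENNReal.ofReal alg.δ := by
          refine ENNReal.tsum_le_of_sum_range_le fun N => ?_
          have hδ := hA.δ_pos
          rw [← ENNReal.ofReal_sum_of_nonneg fun k _ => by unfold RIPSAlg.phaseConf; positivity]
          exact ENNReal.ofReal_le_ofReal (RIPSAlg.sum_phaseConf_le hA N)
  have h1 : (1 : ℝ) ≤ P.real good + P.real goodᶜ := by
    rw [← probReal_univ (μ := P), ← Set.union_compl_self good]
    exact measureReal_union_le _ _
  have h2 : P.real goodᶜ ≤ alg.δ := ENNReal.toReal_le_of_le_ofReal hA.δ_pos.le hbound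
  linarith

end Block

/-! ### The regret bound. -/

section Regret

variable {α : Type u} [Fintype α] [Nonempty α] {Ω : Type w}
  {H : Type v} [NormedAddCommGroup H] [InnerProductSpace ℝ H] [CompleteSpace H]
  {alg : RIPSAlg α H}

/-- The regret bound on the event that all robust means are accurate. -/
lemma regret_le_of_accurate {K : ℝ} (hA : alg.Admissible) {μ : α → ℝ} {θ : H} {h : ℝ}
    (hμ : ∀ a, |μ a - ⟪θ, alg.φ a⟫| ≤ h) (hμK : ∀ a b, μ a - μ b ≤ K)
    (hK : 1 ≤ K * alg.c₁) (hKf : 1 ≤ K * maxDesignValue alg.φ alg.γ)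
    {x : ℕ → Ω → α} {ω : Ω} {z : ℕ → α × ℝ}
    (hacc : ∀ k, alg.MeansAccurate μ (k + 1) (alg.phase z k).2 fun i => z ((alg.phase z k).1 + i))
    (hmem : ∀ t, x t ω ∈ (alg.phase z (alg.phaseAt z t)).2) {T : ℕ} (hT : 2 ≤ T) :
    regret μ x T ω ≤ (24 + 4 * K) * (81 + 4 * K + √K) *
      (alg.c₁ * Real.log (Fintype.card α / alg.δ) +
        √(maxDesignValue alg.φ alg.γ) *
          (T * (h + √alg.γ * ‖θ‖) +
            √(alg.c₀ ^ 2 * (alg.σ ^ 2 + alg.B ^ 2) * T *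
              Real.log (Fintype.card α * Real.log T / alg.δ)))) := by
  have hc₁ := hA.c₁_pos
  have hδ := hA.δ_pos
  have hK0 : 0 < K := by
    by_contra hcon
    nlinarith [mul_nonneg (neg_nonneg.2 (not_lt.1 hcon)) hc₁.le]
  have hh : 0 ≤ h := (abs_nonneg _).trans (hμ (Classical.arbitrary α))
  have hcard : 1 ≤ Fintype.card α := Fintype.card_pos
  set f := maxDesignValue alg.φ alg.γ with hf
  set b := h + √alg.γ * ‖θ‖ with hb
  set S := √(alg.c₀ ^ 2 * (alg.σ ^ 2 + alg.B ^ 2) * T *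
              Real.log (Fintype.card α * Real.log T / alg.δ)) with hS
  have hb0 : 0 ≤ b := by positivity
  have hhb : h ≤ b := le_add_of_nonneg_right (by positivity)
  have hS0 : 0 ≤ S := Real.sqrt_nonneg _
  have hf0 : 0 ≤ √f := Real.sqrt_nonneg _
  have hlogY : 0 ≤ Real.log (Fintype.card α / alg.δ) := by
    refine Real.log_nonneg ((one_le_div hδ).2 (hA.δ_lt_one.le.trans ?_))
    exact_mod_cast hcard
  have hKs : 0 ≤ √K := Real.sqrt_nonneg _
  -- A single arm has zero regret and is set aside because |𝒳|/δ ≥ 2, needed to absorb constants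
  -- into the logarithm, may then fail.
  rcases hcard.eq_or_lt with hone | htwo
  · have := Fintype.card_le_one_iff_subsingleton.1 hone.symm.le
    have hz : regret μ x T ω = 0 := by
      unfold regret
      have : ∀ a, ∑ t ∈ Finset.range T, (μ a - μ (x t ω)) = 0 := fun a =>
        Finset.sum_eq_zero fun t _ => by rw [Subsingleton.elim a (x t ω), sub_self]
      simp [this]
    rw [hz]
    positivity
  have hY : (2 : ℝ) ≤ Fintype.card α / alg.δ := by
    rw [le_div_iff₀ hδ]
    have h2 : (2 : ℝ) ≤ Fintype.card α := by exact_mod_cast htwo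
    linarith [hA.δ_lt_one]
  -- The 2 comes from the fit; √K pays for the bare `h`, since K·f ≥ 1 gives h ≤ √K·√f·b.
  set G := (2 + √K) * (√f * b) with hG
  have hG0 : 0 ≤ G := by positivity
  have hhG : h ≤ √K * (√f * b) := by
    have h1 : 1 ≤ √K * √f := by
      rw [← Real.sqrt_mul hK0.le]
      exact Real.one_le_sqrt.2 hKf
    calc h ≤ 1 * b := by linarith
      _ ≤ (√K * √f) * b := mul_le_mul_of_nonneg_right h1 hb0
      _ = _ := by ring
  have hfit : ∀ k, ∀ y ∈ (alg.phase z k).2,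
      |⟪alg.fit (k + 1) (alg.phase z k).2 (alg.robustMeans (k + 1) (alg.phase z k).2
        fun i => z ((alg.phase z k).1 + i)), alg.φ y⟫ - μ y| ≤ RIPSAlg.eps (k + 1) + G := by
    intro k y hy
    have h1 := (hacc k).abs_fit_sub_le hA hμ (Nat.le_add_left 1 k) hy
    have h2 : √(designValue alg.φ alg.γ (alg.phase z k).2) * b ≤ √f * b :=
      mul_le_mul_of_nonneg_right (Real.sqrt_le_sqrt (designValue_le_max _ _ _)) hb0
    linarith
  have hsum := RIPSAlg.sum_eps_phaseAt_le hA hK hY hT z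
  have hreg : regret μ x T ω ≤ (24 + 4 * K) *
      (∑ t ∈ Finset.range T, RIPSAlg.eps (alg.phaseAt z t + 1) + T * G) := by
    refine ciSup_le fun a => ?_
    calc _ ≤ ∑ t ∈ Finset.range T, (24 + 4 * K) * (RIPSAlg.eps (alg.phaseAt z t + 1) + G) :=
          Finset.sum_le_sum fun t _ =>
            RIPSAlg.gap_le_of_fit_accurate hG0 hK0.le hμK hfit _ (hmem t) a
      _ = _ := by
          rw [← Finset.mul_sum, Finset.sum_add_distrib, Finset.sum_const, Finset.card_range,
            nsmul_eq_mul]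
  refine hreg.trans ?_
  rw [mul_assoc]
  refine mul_le_mul_of_nonneg_left ?_ (by positivity)
  have hu : 0 ≤ alg.c₁ * Real.log (Fintype.card α / alg.δ) := by positivity
  have hv : 0 ≤ √f * (T * b) := by positivity
  have hw : 0 ≤ √f * S := by positivity
  calc _ ≤ ((13 + 4 * K) * (alg.c₁ * Real.log (Fintype.card α / alg.δ)) + 81 * (√f * S)) +
        (2 + √K) * (√f * (T * b)) := by
        have : T * G = (2 + √K) * (√f * (T * b)) := by rw [hG]; ring
        linarith
    _ ≤ (81 + 4 * K + √K) * (alg.c₁ * Real.log (Fintype.card α / alg.δ)) +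
        (81 + 4 * K + √K) * (√f * S) + (81 + 4 * K + √K) * (√f * (T * b)) := by
        exact add_le_add (add_le_add (mul_le_mul_of_nonneg_right (by linarith) hu)
          (mul_le_mul_of_nonneg_right (by linarith) hw))
          (mul_le_mul_of_nonneg_right (by linarith) hv)
    _ = _ := by ring

end Regret

theorem theorem3 (K : ℝ) :
    ∃ C : ℝ, 0 < C ∧
      ∀ (α : Type u) [Fintype α] [MeasurableSpace α] [MeasurableSingletonClass α]
        (H : Type v) [NormedAddCommGroup H] [InnerProductSpace ℝ H] [CompleteSpace H]
        (Ω : Type w) [MeasurableSpace Ω] (P : Measure Ω) [IsProbabilityMeasure P]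
        (alg : RIPSAlg α H) (μ : α → ℝ) (θ : H) (h : ℝ)
        (x : ℕ → Ω → α) (ξ : ℕ → Ω → ℝ),
        alg.Admissible →
        (∀ a, |μ a - ⟪θ, alg.φ a⟫| ≤ h) →
        (∀ a, |μ a| ≤ alg.B) →
        IsNoise P alg.σ x ξ →
        IsPlayedBy alg P μ x ξ →
        ((∀ s t, IdentDistrib (ξ s) (ξ t) P P) ∧
            (∀ l : ℕ, 1 ≤ l → IsRobust alg.c₀ alg.c₁ (alg.phaseConf l) (alg.est l)) ∨
          (∀ l : ℕ, 1 ≤ l → IsRobustIndep alg.c₀ alg.c₁ (alg.phaseConf l) (alg.est l))) →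
        (∀ a b, μ a - μ b ≤ K) →
        1 ≤ K * alg.c₁ →
        1 ≤ K * maxDesignValue alg.φ alg.γ →
        1 - alg.δ ≤ P.real {ω | ∀ T : ℕ, 2 ≤ T →
          regret μ x T ω ≤ C *
            (alg.c₁ * Real.log (Fintype.card α / alg.δ) +
              √(maxDesignValue alg.φ alg.γ) *
                (T * (h + √alg.γ * ‖θ‖) +
                  √(alg.c₀ ^ 2 * (alg.σ ^ 2 + alg.B ^ 2) * T *
                    Real.log (Fintype.card α * Real.log T / alg.δ))))} := by
  -- The absolute values keep the constant positive for every K; any actual instance forces K ≥ 0,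
  -- by comparing an arm with itself.
  refine ⟨(24 + 4 * |K|) * (81 + 4 * |K| + √|K|), by positivity, ?_⟩
  intro α _ _ _ H _ _ _ Ω _ P _ alg μ θ h x ξ hA hμ hB hN hP hrob hμK hK hKf
  obtain ⟨ω₀⟩ := nonempty_of_isProbabilityMeasure P
  have : Nonempty α := ⟨x 0 ω₀⟩
  have hK0 : 0 ≤ K := (sub_self (μ (x 0 ω₀))).symm.le.trans (hμK _ _)
  rw [abs_of_nonneg hK0]
  refine (one_sub_le_measure_accurate hA hB hN hP hrob).trans ?_
  refine ENNReal.toReal_mono (measure_ne_top _ _) (measure_mono_ae ?_)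
  filter_upwards [ae_forall_mem_active hA hN hP] with ω hmem hacc T hT
  exact regret_le_of_accurate hA hμ hμK hK hKf hacc hmem hT
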